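/- Fix $L>0$. Let $\xi_0,\xi_1,\dots$ be independent standard complex Gaussian random variables (each with density $\pi^{-1}e^{-|z|^2}$ on $\mathbb{C}$), let $$f_L(z)=\sum_{n\ge 0}\xi_n\sqrt{\frac{L(L+1)\cdots(L+n-1)}{n!}}\,z^n,\qquad |z|<1,$$ be the hyperbolic Gaussian analytic function, and for $0<r<1$ let $n_L(r)=\#\{z : f_L(z)=0,\ |z|\le r\}$. Then there are constants $C_L,a_L,A_L>0$, depending only on $L$, such that for all $r\in[\tfrac12,1)$ and all real $V>1$ with $$V\ge \frac{C_L}{1-r}\log\frac{1}{1-r},$$ we have $$a_L\,(1-r)V^2\le -\log\mathbb{P}\left[n_L(r)\ge V\right]\le A_L\,(1-r)V^2 .$$ -/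

import Mathlib

open MeasureTheory ProbabilityTheory Set
open scoped ENNReal

noncomputable section

/-- The standard complex Gaussian distribution: density `π⁻¹ exp (-|z|²)` with respect to planar
Lebesgue measure, so that the mean is `0` and the mean of `|z|²` is `1`. -/
def stdComplexGaussian : Measure ℂ :=
  (volume : Measure ℂ).withDensity fun z => ENNReal.ofReal (Real.exp (-‖z‖ ^ 2) / Real.pi)

/-- `ξ 0, ξ 1, …` are independent standard complex Gaussian random variables on `(Ω, P)`. -/
structure IsGaussianSequence {Ω : Type*} [MeasurableSpace Ω] (P : Measure Ω)
    (ξ : ℕ → Ω → ℂ) : Prop where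
  hasLaw : ∀ n, HasLaw (ξ n) stdComplexGaussian P
  indep : iIndepFun ξ P

/-- The Taylor coefficient `√(L (L + 1) ⋯ (L + n - 1) / n!)`. -/
def hypCoeff (L : ℝ) (n : ℕ) : ℝ :=
  Real.sqrt ((∏ k ∈ Finset.range n, (L + k)) / (n.factorial : ℝ))

/-- The hyperbolic power series `∑ₙ xₙ √(L (L + 1) ⋯ (L + n - 1) / n!) zⁿ` with the sequence `x`;
the hyperbolic GAF is obtained by taking for `x` a standard complex Gaussian sequence (the series
then converges at every point of the open unit disk, almost surely). -/
def hypGAF (L : ℝ) (x : ℕ → ℂ) (z : ℂ) : ℂ :=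
  ∑' n : ℕ, x n * (hypCoeff L n : ℂ) * z ^ n

/-- The number of zeros of the series in the closed disk of radius `r` about the origin. -/
def zeroCount (L : ℝ) (x : ℕ → ℂ) (r : ℝ) : ℕ∞ :=
  {z : ℂ | hypGAF L x z = 0 ∧ ‖z‖ ≤ r}.encard

/-- The overcrowding event `n_L(r) ≥ V`. -/
def overcrowding {Ω : Type*} (L : ℝ) (ξ : ℕ → Ω → ℂ) (r V : ℝ) : Set Ω :=
  {ω | ENNReal.ofReal V ≤ (zeroCount L (fun n => ξ n ω) r : ℝ≥0∞)}

end

/-! Write δ = 1 - r, and let N be V rounded up. The hypothesis on V makes δN dominate any fixed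
multiple of log N (`exists_log_le_mul`), so powers of N cost only small multiples of δN in
exponents.

Overcrowding is unlikely. Outside an event of probability at most 4 exp(-N²/2), |f| is bounded by a
power M of N on |z| ≤ R = 1 - δ/2. If f has N zeros in |z| ≤ r, Jensen's formula between the circles
r and R (`card_zeros_mul_log_add_circleAverage_le`) forces the mean of log |f| on the circle r below
log M - N log (R/r), which is about -δN/2. By convexity of exp, the integral over rotations of ∏
1/|f| over the vertices of a regular K-gon is then at least 2π exp(K(N log (R/r) - log M)). Its
expectation is moderate: given the tail, the values at the vertices are an affine image of the first
K coefficients, with matrix a discrete Fourier matrix times a diagonal one. Its determinant is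
controlled, and 1/|y| is locally integrable in the plane
(`lintegral_prod_truncInvNorm_hypSplit_le`). With K about N/16, the determinant costs at most half
of the gain from Jensen, and Markov's inequality gives exp(-cδN²).

Overcrowding is likely enough. Let the coefficient of z^m, with m = N, have size of order one, let
ξ₀ be comparable to q = b_m r^m (b_m the Taylor weight), and make all other coefficients up to index
2m tiny, of size ε = exp(-O(δm)). With linear growth beyond 2m, f is a small perturbation of α +
βz^m in the disk and has m distinct zeros there (`le_encard_zeros_of_near_binomial`). Each of the 2m
+ 1 constraints has probability at least of order ε², so the event has probability at least
exp(-O(δm²)) (`exists_overcrowding_event`). -/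

open scoped Matrix

/-! ### Planar Gaussians and the law of the coefficient sequence -/

/-- Product functions integrate to products over finite product measures, in `ℝ≥0∞`. -/
theorem lintegral_fin_prod_eq_prod {E : Type*} [MeasurableSpace E] (m : Measure E) [SigmaFinite m]
    (n : ℕ) (f : Fin n → E → ℝ≥0∞) (hf : ∀ i, Measurable (f i)) :
    ∫⁻ x : Fin n → E, ∏ i, f i (x i) ∂(Measure.pi fun _ => m) = ∏ i, ∫⁻ x, f i x ∂m := by
  induction n with
  | zero => simp
  | succ n ih =>
    rw [← ((measurePreserving_piFinSuccAbove (fun _ : Fin (n + 1) => m) 0).symm).lintegral_comp]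
    · simp only [Fin.prod_univ_succ, MeasurableEquiv.piFinSuccAbove_symm_apply, Fin.insertNthEquiv,
        Equiv.coe_fn_mk, Fin.insertNth_zero, Fin.cons_zero, Fin.cons_succ]
      rw [← ih (fun i => f i.succ) (fun i => hf _)]
      exact lintegral_prod_mul (f := f 0) (g := fun y : Fin n → E => ∏ i : Fin n, f i.succ (y i))
        (hf 0).aemeasurable (Finset.measurable_fun_prod _ fun i _ =>
          (hf i.succ).comp (measurable_pi_apply i)).aemeasurable
    · fun_prop

theorem integral_exp_neg_mul_norm_sq_complex {b : ℝ} (hb : 0 < b) :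
    ∫ z : ℂ, Real.exp (-b * ‖z‖ ^ 2) = Real.pi / b := by
  rw [GaussianFourier.integral_rexp_neg_mul_sq_norm hb, Complex.finrank_real_complex]
  norm_num

theorem integrable_exp_neg_mul_norm_sq_complex {b : ℝ} (hb : 0 < b) :
    Integrable fun z : ℂ => Real.exp (-b * ‖z‖ ^ 2) := by
  apply Integrable.of_integral_ne_zero
  rw [integral_exp_neg_mul_norm_sq_complex hb]
  positivity

theorem lintegral_exp_neg_mul_norm_sq_complex {b : ℝ} (hb : 0 < b) :
    ∫⁻ z : ℂ, ENNReal.ofReal (Real.exp (-b * ‖z‖ ^ 2) / Real.pi) = ENNReal.ofReal b⁻¹ := by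
  rw [← ofReal_integral_eq_lintegral_ofReal
    ((integrable_exp_neg_mul_norm_sq_complex hb).div_const _) (ae_of_all _ fun z => by positivity),
    integral_div, integral_exp_neg_mul_norm_sq_complex hb]
  congr 1
  field_simp

theorem stdComplexGaussian_density_measurable :
    Measurable fun z : ℂ => ENNReal.ofReal (Real.exp (-‖z‖ ^ 2) / Real.pi) := by
  fun_prop

instance stdComplexGaussian_isProbabilityMeasure : IsProbabilityMeasure stdComplexGaussian := by
  constructor
  rw [stdComplexGaussian, withDensity_apply _ MeasurableSet.univ, Measure.restrict_univ]
  simpa using lintegral_exp_neg_mul_norm_sq_complex one_pos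

/-- Half of the exponent |z|² is replaced by t²/2; the other half still integrates, to 2. -/
theorem stdComplexGaussian_norm_gt_le (t : ℝ) (ht : 0 ≤ t) :
    stdComplexGaussian {z | t < ‖z‖} ≤ ENNReal.ofReal (2 * Real.exp (-t ^ 2 / 2)) := by
  have hm : MeasurableSet {z : ℂ | t < ‖z‖} := measurableSet_lt measurable_const measurable_norm
  rw [stdComplexGaussian, withDensity_apply _ hm]
  calc ∫⁻ z in {z : ℂ | t < ‖z‖}, ENNReal.ofReal (Real.exp (-‖z‖ ^ 2) / Real.pi)
      ≤ ∫⁻ z in {z : ℂ | t < ‖z‖}, ENNReal.ofReal (Real.exp (-t ^ 2 / 2)) *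
          ENNReal.ofReal (Real.exp (-(1 / 2) * ‖z‖ ^ 2) / Real.pi) := by
        refine setLIntegral_mono' hm fun z hz => ?_
        rw [← ENNReal.ofReal_mul (by positivity), ← mul_div_assoc, ← Real.exp_add]
        have : t < ‖z‖ := hz
        gcongr
        nlinarith [sq_nonneg (‖z‖ - t)]
    _ ≤ ∫⁻ z : ℂ, ENNReal.ofReal (Real.exp (-t ^ 2 / 2)) *
          ENNReal.ofReal (Real.exp (-(1 / 2) * ‖z‖ ^ 2) / Real.pi) := setLIntegral_le_lintegral _ _
    _ = _ := by
        rw [lintegral_const_mul _ (by fun_prop), lintegral_exp_neg_mul_norm_sq_complex (by norm_num),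
          ← ENNReal.ofReal_mul (by positivity)]
        congr 1
        norm_num [mul_comm]

/-- The density is at least its value at radius ‖c‖ + s, and the area πs² cancels the normalisation.
-/
theorem le_stdComplexGaussian_closedBall (c : ℂ) (s : ℝ) (hs : 0 ≤ s) :
    ENNReal.ofReal (Real.exp (-(‖c‖ + s) ^ 2) * s ^ 2) ≤
      stdComplexGaussian (Metric.closedBall c s) := by
  have hm : MeasurableSet (Metric.closedBall c s) := Metric.isClosed_closedBall.measurableSet
  rw [stdComplexGaussian, withDensity_apply _ hm]
  calc ENNReal.ofReal (Real.exp (-(‖c‖ + s) ^ 2) * s ^ 2)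
      = ∫⁻ z in Metric.closedBall c s, ENNReal.ofReal (Real.exp (-(‖c‖ + s) ^ 2) / Real.pi) := by
        rw [setLIntegral_const, Complex.volume_closedBall, ← ENNReal.ofReal_pow hs,
          show (NNReal.pi : ℝ≥0∞) = ENNReal.ofReal Real.pi from
            (ENNReal.ofReal_eq_coe_nnreal Real.pi_pos.le).symm,
          ← ENNReal.ofReal_mul (by positivity), ← ENNReal.ofReal_mul (by positivity)]
        congr 1
        field_simp
    _ ≤ _ := by
        refine setLIntegral_mono' hm fun z hz => ?_
        have h1 : ‖z‖ ≤ ‖c‖ + s := by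
          have := norm_sub_norm_le z c
          rw [Metric.mem_closedBall, dist_eq_norm] at hz
          linarith
        gcongr

theorem stdComplexGaussian_singleton (z : ℂ) : stdComplexGaussian {z} = 0 :=
  withDensity_absolutelyContinuous _ _ (measure_singleton z)

/-- The law of an infinite sequence of independent standard complex Gaussians. -/
noncomputable def gaussianSeqLaw : Measure (ℕ → ℂ) :=
  Measure.infinitePi fun _ => stdComplexGaussian

instance : IsProbabilityMeasure gaussianSeqLaw := by
  unfold gaussianSeqLaw; infer_instance

theorem IsGaussianSequence.hasLaw_seq {Ω : Type*} [MeasurableSpace Ω] {P : Measure Ω}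
    {ξ : ℕ → Ω → ℂ} (h : IsGaussianSequence P ξ) :
    HasLaw (fun ω n => ξ n ω) gaussianSeqLaw P :=
  h.indep.hasLaw_infinitePi h.hasLaw (aemeasurable_pi_iff.2 fun n => (h.hasLaw n).aemeasurable)

theorem gaussianSeqLaw_eval (n : ℕ) {s : Set ℂ} (hs : MeasurableSet s) :
    gaussianSeqLaw {x | x n ∈ s} = stdComplexGaussian s :=
  (measurePreserving_eval_infinitePi (fun _ : ℕ => stdComplexGaussian) n).measure_preimage
    hs.nullMeasurableSet

/-- The sequence that begins with the vector `x` and continues with the sequence `y`. -/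
def appendSeq {E : Type*} {K : ℕ} (x : Fin K → E) (y : ℕ → E) (n : ℕ) : E :=
  if h : n < K then x ⟨n, h⟩ else y (n - K)

theorem appendSeq_fin {E : Type*} {K : ℕ} (x : Fin K → E) (y : ℕ → E) (k : Fin K) :
    appendSeq x y k = x k := by
  simp [appendSeq]

theorem appendSeq_add {E : Type*} {K : ℕ} (x : Fin K → E) (y : ℕ → E) (n : ℕ) :
    appendSeq x y (K + n) = y n := by
  simp [appendSeq]

theorem measurable_appendSeq {E : Type*} [MeasurableSpace E] (K : ℕ) :
    Measurable fun p : (Fin K → E) × (ℕ → E) => appendSeq p.1 p.2 := by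
  refine measurable_pi_iff.2 fun n => ?_
  unfold appendSeq
  split_ifs <;> fun_prop

/-- Independence of head and tail, checked on finite cylinders. It allows the first K coefficients
to be integrated out with the tail frozen. -/
theorem measurePreserving_appendSeq (K : ℕ) :
    MeasurePreserving (fun p : (Fin K → ℂ) × (ℕ → ℂ) => appendSeq p.1 p.2)
      ((Measure.pi fun _ => stdComplexGaussian).prod gaussianSeqLaw) gaussianSeqLaw := by
  refine ⟨measurable_appendSeq K, ?_⟩
  refine Measure.eq_infinitePi _ fun s t ht => ?_
  rw [Measure.map_apply (measurable_appendSeq K)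
    (MeasurableSet.pi s.countable_toSet fun i _ => ht i)]
  set s₂ : Finset ℕ := (s.filter fun n => K ≤ n).image fun n => n - K with hs₂
  have hpre : (fun p : (Fin K → ℂ) × (ℕ → ℂ) => appendSeq p.1 p.2) ⁻¹' Set.pi s t
      = (Set.univ.pi fun k : Fin K => if (k : ℕ) ∈ s then t k else Set.univ) ×ˢ
        Set.pi s₂ fun n => t (K + n) := by
    ext ⟨x, y⟩
    simp only [Set.mem_preimage, Set.mem_pi, Set.mem_prod, Set.mem_univ, true_implies,
      Finset.mem_coe]
    constructor
    · intro h
      refine ⟨fun k => ?_, fun n hn => ?_⟩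
      · split_ifs with hk
        · simpa [appendSeq_fin] using h k hk
        · trivial
      · rw [hs₂, Finset.mem_image] at hn
        obtain ⟨m, hm, rfl⟩ := hn
        rw [Finset.mem_filter] at hm
        have := h m hm.1
        rw [← appendSeq_add x y, Nat.add_sub_cancel' hm.2]
        exact this
    · rintro ⟨h1, h2⟩ n hn
      by_cases hK : n < K
      · have := h1 ⟨n, hK⟩
        rw [if_pos hn] at this
        simpa [appendSeq, hK] using this
      · push Not at hK
        have := h2 (n - K) (by rw [hs₂, Finset.mem_image]; exact ⟨n, by simp [hn, hK], rfl⟩)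
        rw [← appendSeq_add x y, Nat.add_sub_cancel' hK] at this
        exact this
  have htail : gaussianSeqLaw (Set.pi s₂ fun n => t (K + n))
      = ∏ n ∈ s₂, stdComplexGaussian (t (K + n)) :=
    Measure.infinitePi_pi (μ := fun _ : ℕ => stdComplexGaussian) (fun _ _ => ht _)
  rw [hpre, Measure.prod_prod, Measure.pi_pi, htail]
  rw [← Finset.prod_filter_mul_prod_filter_not s (fun n => n < K)]
  congr 1
  · rw [Finset.prod_filter, ← Finset.prod_filter_mul_prod_filter_not Finset.univ
      (fun k : Fin K => (k : ℕ) ∈ s)]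
    rw [Finset.prod_congr rfl (g := fun k : Fin K => stdComplexGaussian (t k))
      (fun k hk => by rw [if_pos (Finset.mem_filter.1 hk).2]),
      Finset.prod_congr (s₁ := Finset.univ.filter fun k : Fin K => ¬ (k : ℕ) ∈ s) rfl
        (g := fun k : Fin K => (1 : ℝ≥0∞))
        (fun k hk => by rw [if_neg (Finset.mem_filter.1 hk).2, measure_univ]),
      Finset.prod_const_one, mul_one, ← Finset.prod_filter]
    refine Finset.prod_bij (fun k _ => (k : ℕ)) ?_ ?_ ?_ ?_
    · intro k hk; simpa using hk
    · intro a _ b _ h; exact Fin.ext h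
    · intro n hn
      rw [Finset.mem_filter] at hn
      exact ⟨⟨n, hn.2⟩, by simpa using hn.1, rfl⟩
    · intro k _; rfl
  · simp only [not_lt]
    rw [hs₂, Finset.prod_image]
    · refine Finset.prod_congr rfl fun n hn => ?_
      rw [Nat.add_sub_cancel' (Finset.mem_filter.1 hn).2]
    · intro a ha b hb h
      have := (Finset.mem_filter.1 ha).2
      have := (Finset.mem_filter.1 hb).2
      simp only at h
      omega

/-! ### Polynomial bounds for the Taylor weights -/

theorem hypCoeff_nonneg (L : ℝ) (n : ℕ) : 0 ≤ hypCoeff L n := Real.sqrt_nonneg _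

theorem hypCoeff_sq {L : ℝ} (hL : 0 < L) (n : ℕ) :
    hypCoeff L n ^ 2 = (∏ k ∈ Finset.range n, (L + k)) / (n.factorial : ℝ) := by
  rw [hypCoeff, Real.sq_sqrt]
  exact div_nonneg (Finset.prod_nonneg fun k _ => by positivity) (by positivity)

theorem hypCoeff_sq_succ {L : ℝ} (hL : 0 < L) (n : ℕ) :
    hypCoeff L (n + 1) ^ 2 = hypCoeff L n ^ 2 * ((L + n) / (n + 1)) := by
  rw [hypCoeff_sq hL, hypCoeff_sq hL, Finset.prod_range_succ, Nat.factorial_succ]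
  push_cast
  field_simp

theorem hypCoeff_zero {L : ℝ} : hypCoeff L 0 = 1 := by simp [hypCoeff]

/-- Telescoping: by Bernoulli, the ratio (L + n)/(n + 1) is at most ((n + 2)/(n + 1))^p. The
exponent is not sharp, but any power of n is harmless. -/
theorem hypCoeff_sq_le {L : ℝ} (hL : 0 < L) {p : ℕ} (hp : L ≤ p) (n : ℕ) :
    hypCoeff L n ^ 2 ≤ ((n : ℝ) + 1) ^ p := by
  induction n with
  | zero => simp [hypCoeff_zero]
  | succ n ih =>
    rw [hypCoeff_sq_succ hL]
    have h1 : (L + n) / (n + 1) ≤ (1 + 1 / ((n : ℝ) + 1)) ^ p := by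
      refine le_trans ?_ (one_add_mul_le_pow (a := 1 / ((n : ℝ) + 1)) ?_ p)
      · rw [div_le_iff₀ (by positivity)]
        field_simp
        nlinarith
      · have : 0 < 1 / ((n : ℝ) + 1) := by positivity
        linarith
    calc hypCoeff L n ^ 2 * ((L + n) / (n + 1))
        ≤ ((n : ℝ) + 1) ^ p * (1 + 1 / ((n : ℝ) + 1)) ^ p := by gcongr
      _ = _ := by
        rw [← mul_pow]
        congr 1
        push_cast
        field_simp

theorem hypCoeff_le {L : ℝ} (hL : 0 < L) {p : ℕ} (hp : L ≤ p) (n : ℕ) :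
    hypCoeff L n ≤ ((n : ℝ) + 1) ^ p := by
  have h1 := hypCoeff_sq_le hL hp n
  have h2 : (1 : ℝ) ≤ ((n : ℝ) + 1) ^ p := one_le_pow₀ (by linarith [n.cast_nonneg (α := ℝ)])
  nlinarith [hypCoeff_nonneg L n]

/-- From index 1 on, where the square is L, each ratio exceeds the factor by which the left side
shrinks. -/
theorem le_hypCoeff_sq {L : ℝ} (hL : 0 < L) (n : ℕ) :
    min L 1 / ((n : ℝ) + 1) ≤ hypCoeff L n ^ 2 := by
  have hc : 0 < min L 1 := lt_min hL one_pos
  have key : ∀ n : ℕ, min L 1 / ((n : ℝ) + 1) ≤ hypCoeff L (n + 1) ^ 2 := by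
    intro n
    induction n with
    | zero => simp [hypCoeff_sq_succ hL, hypCoeff_zero]
    | succ n ih =>
      rw [hypCoeff_sq_succ hL]
      calc min L 1 / (((n + 1 : ℕ) : ℝ) + 1)
          = min L 1 / ((n : ℝ) + 1) * (((n : ℝ) + 1) / (((n + 1 : ℕ) : ℝ) + 1)) := by
            field_simp
        _ ≤ hypCoeff L (n + 1) ^ 2 * ((L + (n + 1 : ℕ)) / ((n + 1 : ℕ) + 1)) := by
            refine mul_le_mul ih ?_ (by positivity) (sq_nonneg _)
            push_cast
            exact div_le_div_of_nonneg_right (by linarith) (by positivity)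
  rcases n with _ | n
  · simp [hypCoeff_zero]
  · refine le_trans ?_ (key n)
    gcongr
    linarith

theorem hypCoeff_pos {L : ℝ} (hL : 0 < L) (n : ℕ) : 0 < hypCoeff L n := by
  have h := le_hypCoeff_sq hL n
  have : 0 < min L 1 / ((n : ℝ) + 1) := div_pos (lt_min hL one_pos) (by positivity)
  exact lt_of_le_of_ne (hypCoeff_nonneg L n) fun h0 => by rw [← h0] at h; norm_num at h; linarith

/-! ### The range of V, and growth of the series -/

/-- Once `x` exceeds a large multiple of `δ⁻¹ log δ⁻¹`, the product `δ x` dominates `log x`. -/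
theorem exists_log_le_mul {D : ℝ} (hD : 0 < D) :
    ∃ C : ℝ, 0 < C ∧ ∀ δ x : ℝ, 0 < δ → δ ≤ 1 / 2 → C / δ * Real.log (1 / δ) ≤ x →
      D ≤ δ * x ∧ 2 / δ ≤ x ∧ D * Real.log x ≤ δ * x := by
  refine ⟨32 * D ^ 2 + 2 * D + 4, by positivity, fun δ x hδ hδ2 hx => ?_⟩
  set C := 32 * D ^ 2 + 2 * D + 4 with hC
  have hC0 : 0 < C := by positivity
  have hlog2 : 1 / 2 ≤ Real.log (1 / δ) := by
    have h1 := Real.log_two_gt_d9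
    have h2 : Real.log 2 ≤ Real.log (1 / δ) :=
      Real.log_le_log (by norm_num) (by rw [le_div_iff₀ hδ]; linarith)
    linarith
  have hy : C * Real.log (1 / δ) ≤ δ * x := by
    have := mul_le_mul_of_nonneg_left hx hδ.le
    calc C * Real.log (1 / δ) = δ * (C / δ * Real.log (1 / δ)) := by field_simp
      _ ≤ _ := this
  have hy2 : C / 2 ≤ δ * x := by nlinarith
  have hy0 : 0 < δ * x := by linarith
  have hx0 : 0 < x := by
    rcases pos_and_pos_or_neg_and_neg_of_mul_pos hy0 with h | h
    · exact h.2
    · linarith [h.1]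
  refine ⟨by nlinarith, ?_, ?_⟩
  · rw [div_le_iff₀ hδ]
    nlinarith
  -- The term log (δx) is beaten by its square root, and log (1/δ) by the hypothesis on x.
  · have hsplit : Real.log x = Real.log (δ * x) + Real.log (1 / δ) := by
      rw [Real.log_mul hδ.ne' hx0.ne', one_div, Real.log_inv]; ring
    have hs : Real.log (δ * x) ≤ 2 * Real.sqrt (δ * x) := by
      have h1 := Real.log_le_sub_one_of_pos (Real.sqrt_pos.2 hy0)
      rw [Real.log_sqrt hy0.le] at h1
      linarith
    have hsq : 4 * D ≤ Real.sqrt (δ * x) := by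
      apply Real.le_sqrt_of_sq_le
      nlinarith
    have h2 : D * (2 * Real.sqrt (δ * x)) ≤ δ * x / 2 := by
      nlinarith [Real.mul_self_sqrt hy0.le, Real.sqrt_nonneg (δ * x)]
    have h3 : D * Real.log (1 / δ) ≤ δ * x / 2 := by nlinarith
    rw [hsplit]
    nlinarith

/-- Comparison with the negative binomial series, since (n + 1)^k ≤ k! · C(n + k, k). -/
theorem summable_pow_mul_geometric_succ (k : ℕ) {R : ℝ} (hR0 : 0 ≤ R) (hR : R < 1) :
    (Summable fun n : ℕ => ((n : ℝ) + 1) ^ k * R ^ n) ∧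
      ∑' n : ℕ, ((n : ℝ) + 1) ^ k * R ^ n ≤ k.factorial / (1 - R) ^ (k + 1) := by
  have hRn : ‖R‖ < 1 := by rwa [Real.norm_of_nonneg hR0]
  have hs := (summable_choose_mul_geometric_of_norm_lt_one k hRn).mul_left (k.factorial : ℝ)
  have hle : ∀ n : ℕ, ((n : ℝ) + 1) ^ k * R ^ n ≤
      (k.factorial : ℝ) * (((n + k).choose k : ℝ) * R ^ n) := by
    intro n
    rw [← mul_assoc]
    gcongr
    have h1 := Nat.pow_succ_le_ascFactorial (n + 1) k
    rw [Nat.ascFactorial_eq_factorial_mul_choose] at h1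
    exact_mod_cast h1
  have hsum := Summable.of_nonneg_of_le (fun n => by positivity) hle hs
  refine ⟨hsum, (hsum.tsum_le_tsum hle hs).trans ?_⟩
  rw [tsum_mul_left, tsum_choose_mul_geometric_of_norm_lt_one k hRn, mul_one_div]

theorem norm_hypGAF_term_le {L : ℝ} (hL : 0 < L) {p : ℕ} (hp : L ≤ p) {x : ℕ → ℂ} {t R : ℝ}
    (ht : 0 ≤ t) (hx : ∀ n, ‖x n‖ ≤ t * (n + 1)) {z : ℂ} (hz : ‖z‖ ≤ R) (n : ℕ) :
    ‖x n * (hypCoeff L n : ℂ) * z ^ n‖ ≤ t * (((n : ℝ) + 1) ^ (p + 1) * R ^ n) := by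
  rw [norm_mul, norm_mul, norm_pow, Complex.norm_real, Real.norm_of_nonneg (hypCoeff_nonneg L n)]
  calc ‖x n‖ * hypCoeff L n * ‖z‖ ^ n ≤ (t * (n + 1)) * ((n : ℝ) + 1) ^ p * R ^ n := by
        gcongr
        · exact hypCoeff_nonneg L n
        · exact hx n
        · exact hypCoeff_le hL hp n
    _ = _ := by ring

theorem summable_hypGAF {L : ℝ} (hL : 0 < L) {x : ℕ → ℂ} {t : ℝ}
    (hx : ∀ n, ‖x n‖ ≤ t * (n + 1)) {z : ℂ} (hz : ‖z‖ < 1) :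
    Summable fun n => ‖x n * (hypCoeff L n : ℂ) * z ^ n‖ := by
  obtain ⟨p, hp⟩ := exists_nat_ge L
  have ht : 0 ≤ t := by simpa using (norm_nonneg _).trans (hx 0)
  exact Summable.of_nonneg_of_le (fun n => norm_nonneg _)
    (fun n => norm_hypGAF_term_le hL hp ht hx le_rfl n)
    ((summable_pow_mul_geometric_succ (p + 1) (norm_nonneg z) hz).1.mul_left t)

theorem norm_hypGAF_le {L : ℝ} (hL : 0 < L) {p : ℕ} (hp : L ≤ p) {x : ℕ → ℂ} {t R : ℝ}
    (hx : ∀ n, ‖x n‖ ≤ t * (n + 1)) (hR : R < 1) {z : ℂ} (hz : ‖z‖ ≤ R) :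
    ‖hypGAF L x z‖ ≤ t * ((p + 1).factorial / (1 - R) ^ (p + 2)) := by
  have ht : 0 ≤ t := by simpa using (norm_nonneg _).trans (hx 0)
  have h := summable_pow_mul_geometric_succ (p + 1) ((norm_nonneg z).trans hz) hR
  refine (tsum_of_norm_bounded (h.1.mul_left t).hasSum
    (norm_hypGAF_term_le hL hp ht hx hz)).trans ?_
  rw [tsum_mul_left]
  gcongr
  exact h.2

theorem differentiableOn_hypGAF {L : ℝ} (hL : 0 < L) {x : ℕ → ℂ} {t : ℝ}
    (hx : ∀ n, ‖x n‖ ≤ t * (n + 1)) :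
    DifferentiableOn ℂ (hypGAF L x) (Metric.ball 0 1) := by
  obtain ⟨p, hp⟩ := exists_nat_ge L
  have ht : 0 ≤ t := by simpa using (norm_nonneg _).trans (hx 0)
  intro z hz
  rw [Metric.mem_ball, dist_zero_right] at hz
  obtain ⟨R, hzR, hR⟩ := exists_between hz
  have h := summable_pow_mul_geometric_succ (p + 1) ((norm_nonneg z).trans hzR.le) hR
  have hd : DifferentiableOn ℂ (hypGAF L x) (Metric.ball 0 R) := by
    refine Complex.differentiableOn_tsum_of_summable_norm (h.1.mul_left t)
      (fun n => by fun_prop) Metric.isOpen_ball fun n w hw => ?_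
    rw [Metric.mem_ball, dist_zero_right] at hw
    exact norm_hypGAF_term_le hL hp ht hx hw.le n
  exact (hd.differentiableAt (Metric.isOpen_ball.mem_nhds (by simpa using hzR))
    ).differentiableWithinAt

/-! ### Jensen's formula and convexity over a polygon -/

/-- **Jensen's formula** as an inequality between two circles: every zero in the smaller closed
disk contributes `log (R / r)` to the growth of the mean of `log ‖f‖`. -/
theorem card_zeros_mul_log_add_circleAverage_le {f : ℂ → ℂ} {r R : ℝ} (hr : 0 < r) (hrR : r < R)
    (hf : AnalyticOnNhd ℂ f (Metric.closedBall 0 R)) (h0 : f 0 ≠ 0) (Z : Finset ℂ)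
    (hZ : ∀ z ∈ Z, f z = 0 ∧ ‖z‖ ≤ r) :
    Z.card * Real.log (R / r) + Real.circleAverage (Real.log ‖f ·‖) 0 r ≤
      Real.circleAverage (Real.log ‖f ·‖) 0 R := by
  have hR : 0 < R := hr.trans hrR
  have hsub : Metric.closedBall (0 : ℂ) r ⊆ Metric.closedBall 0 R :=
    Metric.closedBall_subset_closedBall hrR.le
  have hfr : AnalyticOnNhd ℂ f (Metric.closedBall 0 r) := hf.mono hsub
  have h0mem : (0 : ℂ) ∈ Metric.closedBall 0 R := Metric.mem_closedBall_self hR.le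
  set DR := MeromorphicOn.divisor f (Metric.closedBall 0 R) with hDR
  set Dr := MeromorphicOn.divisor f (Metric.closedBall 0 r) with hDr
  have ord0 : analyticOrderAt f 0 = 0 := (hf 0 h0mem).analyticOrderAt_eq_zero.2 h0
  have hDR0 : DR 0 = 0 := by rw [hDR, MeromorphicOn.AnalyticOnNhd.divisor_apply hf h0mem, ord0]; simp
  have hDr0 : Dr 0 = 0 := by
    rw [hDr, MeromorphicOn.AnalyticOnNhd.divisor_apply hfr (Metric.mem_closedBall_self hr.le), ord0]; simp
  have heq : ∀ u ∈ Metric.closedBall (0 : ℂ) r, Dr u = DR u := fun u hu => by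
    rw [hDr, hDR, MeromorphicOn.AnalyticOnNhd.divisor_apply hfr hu, MeromorphicOn.AnalyticOnNhd.divisor_apply hf (hsub hu)]
  have hDrout : ∀ u ∉ Metric.closedBall (0 : ℂ) r, Dr u = 0 := fun u hu =>
    Function.locallyFinsuppWithin.apply_eq_zero_of_notMem _ hu
  have hDRout : ∀ u ∉ Metric.closedBall (0 : ℂ) R, DR u = 0 := fun u hu =>
    Function.locallyFinsuppWithin.apply_eq_zero_of_notMem _ hu
  have hDRnn : ∀ u, 0 ≤ DR u := fun u => MeromorphicOn.AnalyticOnNhd.divisor_nonneg hf u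
  -- The zeros in Z are distinct points, while the divisor counts multiplicity. The order is finite
  -- because f does not vanish at 0.
  have hone : ∀ z ∈ Z, 1 ≤ DR z := by
    intro z hz
    obtain ⟨hz1, hz2⟩ := hZ z hz
    have hzR : z ∈ Metric.closedBall (0 : ℂ) R := hsub (by simpa using hz2)
    have hne0 : analyticOrderAt f z ≠ 0 := fun h => (hf z hzR).analyticOrderAt_eq_zero.1 h hz1
    have hnetop : analyticOrderAt f z ≠ ⊤ :=
      hf.analyticOrderAt_ne_top_of_isPreconnected
        (convex_closedBall (0 : ℂ) R).isPreconnected h0mem hzR (by rw [ord0]; simp)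
    rw [hDR, MeromorphicOn.AnalyticOnNhd.divisor_apply hf hzR]
    obtain ⟨n, hn⟩ := ENat.ne_top_iff_exists.1 hnetop
    rw [← hn] at hne0 ⊢
    have : n ≠ 0 := by rintro rfl; simp at hne0
    simp
    omega
  have hfin : (Function.support DR).Finite := DR.finiteSupport (isCompact_closedBall 0 R)
  set S := hfin.toFinset with hS
  have hJR := MeromorphicOn.circleAverage_log_norm (c := 0) (f := f) hR.ne'
    (by rw [abs_of_pos hR]; exact hf.meromorphicOn)
  have hJr := MeromorphicOn.circleAverage_log_norm (c := 0) (f := f) hr.ne'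
    (by rw [abs_of_pos hr]; exact hfr.meromorphicOn)
  rw [abs_of_pos hR, ← hDR, hDR0] at hJR
  rw [abs_of_pos hr, ← hDr, hDr0] at hJr
  rw [finsum_eq_sum_of_support_subset (s := S)] at hJR
  swap
  · intro u hu
    simp only [hS, Set.Finite.coe_toFinset, Function.mem_support]
    intro h
    simp [h] at hu
  rw [finsum_eq_sum_of_support_subset (s := S)] at hJr
  swap
  · intro u hu
    simp only [hS, Set.Finite.coe_toFinset, Function.mem_support]
    intro h
    by_cases hur : u ∈ Metric.closedBall (0 : ℂ) r
    · simp [heq u hur, h] at hu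
    · simp [hDrout u hur] at hu
  rw [hJR, hJr]
  have hlog : 0 ≤ Real.log (R / r) := Real.log_nonneg (by rw [le_div_iff₀ hr]; linarith)
  have hZS : Z ⊆ S := fun z hz => by
    have := hone z hz
    simp only [hS, Set.Finite.mem_toFinset, Function.mem_support]
    omega
  have hcard : (Z.card : ℝ) * Real.log (R / r)
      = ∑ u ∈ S, if u ∈ Z then Real.log (R / r) else 0 := by
    rw [← Finset.sum_filter, Finset.filter_mem_eq_inter, Finset.inter_eq_right.2 hZS]
    simp
  have hterm : ∑ u ∈ S, ((if u ∈ Z then Real.log (R / r) else 0) +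
      (Dr u : ℝ) * Real.log (r * ‖0 - u‖⁻¹)) ≤
      ∑ u ∈ S, (DR u : ℝ) * Real.log (R * ‖0 - u‖⁻¹) := by
    refine Finset.sum_le_sum fun u hu => ?_
    have huS : DR u ≠ 0 := by simpa [hS] using hu
    have hu0 : u ≠ 0 := by rintro rfl; exact huS hDR0
    have hun : 0 < ‖0 - u‖ := by simpa using hu0
    have huR : ‖0 - u‖ ≤ R := by
      by_contra h
      exact huS (hDRout u (by simpa using h))
    by_cases hur : u ∈ Metric.closedBall (0 : ℂ) r
    · rw [heq u hur]
      have hd : Real.log (R * ‖0 - u‖⁻¹) = Real.log (R / r) + Real.log (r * ‖0 - u‖⁻¹) := by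
        rw [← Real.log_mul (by positivity) (by positivity)]
        congr 1
        field_simp
      rw [hd, mul_add]
      gcongr
      have h1 : (1 : ℝ) ≤ DR u := by exact_mod_cast (by have := hDRnn u; omega : 1 ≤ DR u)
      split_ifs <;> nlinarith
    · have hZu : u ∉ Z := fun h => hur (by simpa using (hZ u h).2)
      rw [hDrout u hur, if_neg hZu]
      have h1 : (0 : ℝ) ≤ DR u := by exact_mod_cast hDRnn u
      have h2 : 0 ≤ Real.log (R * ‖0 - u‖⁻¹) := by
        apply Real.log_nonneg
        rw [← div_eq_mul_inv, le_div_iff₀ hun]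
        linarith
      simpa using mul_nonneg h1 h2
  rw [Finset.sum_add_distrib, ← hcard] at hterm
  push_cast
  linarith

/-- No integrability is needed, as the Bochner integral is 0 by default. -/
theorem ofReal_integral_le_lintegral_ofReal {α : Type*} [MeasurableSpace α] {m : Measure α}
    (g : α → ℝ) : ENNReal.ofReal (∫ a, g a ∂m) ≤ ∫⁻ a, ENNReal.ofReal (g a) ∂m := by
  by_cases hg : Integrable g m
  · rw [integral_eq_lintegral_pos_part_sub_lintegral_neg_part hg]
    refine (ENNReal.ofReal_le_ofReal (sub_le_self _ ENNReal.toReal_nonneg)).trans ?_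
    exact ENNReal.ofReal_toReal_le
  · simp [integral_undef hg]

/-- Jensen's inequality for `exp` and a sum of rotated copies of a function on a circle. -/
theorem ofReal_exp_neg_circleAverage_le {φ : ℂ → ℝ} {r : ℝ} (hφ : CircleIntegrable φ 0 r) {K : ℕ}
    (η : Fin K → ℝ) :
    ENNReal.ofReal (2 * Real.pi * Real.exp (-(K * Real.circleAverage φ 0 r))) ≤
      ∫⁻ θ in Ioc 0 (2 * Real.pi),
        ∏ j, ENNReal.ofReal (Real.exp (-φ (circleMap 0 r (θ + η j)))) := by
  have hpi : 0 < 2 * Real.pi := by positivity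
  set s₀ := K * Real.circleAverage φ 0 r with hs₀
  have hint : ∀ j, IntervalIntegrable (fun θ => φ (circleMap 0 r (θ + η j))) volume
      0 (2 * Real.pi) := by
    intro j
    have hper : Function.Periodic (fun θ => φ (circleMap 0 r θ)) (2 * Real.pi) :=
      fun θ => by simp [periodic_circleMap (0 : ℂ) r θ]
    have h1 : IntervalIntegrable (fun θ => φ (circleMap 0 r θ)) volume (0 + η j)
        (2 * Real.pi + η j) :=
      hper.intervalIntegrable₀ hpi.ne' hφ _ _
    simpa using h1.comp_add_right (η j)
  have havg : ∀ j, ∫ θ in (0 : ℝ)..2 * Real.pi, φ (circleMap 0 r (θ + η j))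
      = 2 * Real.pi * Real.circleAverage φ 0 r := by
    intro j
    rw [Real.circleAverage_eq_integral_add (η j), smul_eq_mul]
    field_simp
  set S : ℝ → ℝ := fun θ => ∑ j, φ (circleMap 0 r (θ + η j)) with hS
  have hSint : IntervalIntegrable S volume 0 (2 * Real.pi) := by
    have h := IntervalIntegrable.sum Finset.univ (fun j _ => hint j)
    rwa [show (∑ j, fun θ => φ (circleMap 0 r (θ + η j))) = S from
      funext fun θ => by simp [hS]] at h
  have hSavg : ∫ θ in (0 : ℝ)..2 * Real.pi, S θ = 2 * Real.pi * s₀ := by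
    rw [hS, intervalIntegral.integral_finsetSum (fun j _ => hint j)]
    simp only [havg, Finset.sum_const, Finset.card_univ, Fintype.card_fin, nsmul_eq_mul, hs₀]
    ring
  -- The tangent line to exp(-S) at the mean s₀ of S is integrated in its place, so exp(-S) itself
  -- need not be integrable.
  have hlin : ∫ θ in Ioc 0 (2 * Real.pi), Real.exp (-s₀) * (1 + s₀ - S θ)
      = 2 * Real.pi * Real.exp (-s₀) := by
    rw [← intervalIntegral.integral_of_le hpi.le, intervalIntegral.integral_const_mul,
      intervalIntegral.integral_sub (by simp) hSint, hSavg, intervalIntegral.integral_const]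
    simp
    ring
  rw [← hlin]
  refine (ofReal_integral_le_lintegral_ofReal _).trans (lintegral_mono fun θ => ?_)
  rw [← ENNReal.ofReal_prod_of_nonneg (fun j _ => (Real.exp_pos _).le), ← Real.exp_sum]
  apply ENNReal.ofReal_le_ofReal
  rw [Finset.sum_neg_distrib]
  calc Real.exp (-s₀) * (1 + s₀ - S θ) ≤ Real.exp (-s₀) * Real.exp (s₀ - S θ) := by
        gcongr
        linarith [Real.add_one_le_exp (s₀ - S θ)]
    _ = Real.exp (-S θ) := by rw [← Real.exp_add]; congr 1; ring

/-! ### Zeros of a perturbed binomial -/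

/-- The remainder is a polynomial in u with nonnegative coefficients, so replacing u by ‖u‖
majorises it. -/
theorem norm_one_add_pow_sub_le (u : ℂ) (m : ℕ) :
    ‖(1 + u) ^ m - 1 - m * u‖ ≤ (1 + ‖u‖) ^ m - 1 - m * ‖u‖ := by
  induction m with
  | zero => simp
  | succ m ih =>
    have h1 : (1 + u) ^ (m + 1) - 1 - ((m + 1 : ℕ) : ℂ) * u
        = ((1 + u) ^ m - 1 - m * u) * (1 + u) + m * u ^ 2 := by push_cast; ring
    rw [h1]
    calc ‖((1 + u) ^ m - 1 - m * u) * (1 + u) + m * u ^ 2‖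
        ≤ ‖(1 + u) ^ m - 1 - m * u‖ * ‖1 + u‖ + m * ‖u‖ ^ 2 := by
          refine (norm_add_le _ _).trans ?_
          rw [norm_mul, norm_mul, norm_pow, Complex.norm_natCast]
      _ ≤ ((1 + ‖u‖) ^ m - 1 - m * ‖u‖) * (1 + ‖u‖) + m * ‖u‖ ^ 2 := by
          gcongr
          · exact (norm_nonneg _).trans ih
          · exact (norm_add_le _ _).trans (by simp)
      _ = _ := by push_cast; ring

/-- The remainder beyond the linear term is at most (m‖u‖)², which is at most half of the linear
term. -/
theorem half_mul_norm_le_norm_one_add_pow_sub_one {u : ℂ} {m : ℕ} (hu : m * ‖u‖ ≤ 1 / 2) :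
    m * ‖u‖ / 2 ≤ ‖(1 + u) ^ m - 1‖ := by
  have h1 := norm_one_add_pow_sub_le u m
  have h0 : 0 ≤ m * ‖u‖ := by positivity
  have h2 : (1 + ‖u‖) ^ m ≤ Real.exp (m * ‖u‖) := by
    rw [Real.exp_nat_mul]
    gcongr
    linarith [Real.add_one_le_exp ‖u‖]
  have h3 : |Real.exp (m * ‖u‖) - 1 - m * ‖u‖| ≤ (m * ‖u‖) ^ 2 :=
    Real.abs_exp_sub_one_sub_id_le (by rw [abs_of_nonneg h0]; linarith)
  have h4 : ‖(m : ℂ) * u‖ - ‖(1 + u) ^ m - 1‖ ≤ ‖(1 + u) ^ m - 1 - m * u‖ := by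
    rw [norm_sub_rev ((1 + u) ^ m - 1)]
    exact norm_sub_norm_le _ _
  rw [norm_mul, Complex.norm_natCast] at h4
  nlinarith [le_abs_self (Real.exp (m * ‖u‖) - 1 - m * ‖u‖)]

/-- A small perturbation of `α + β z ^ m` has a zero near each root. -/
theorem exists_zero_near_root {f : ℂ → ℂ} {r η : ℝ} {α β ζ : ℂ} {m : ℕ} (hm : 0 < m) (hr : 0 < r)
    (hf : DifferentiableOn ℂ f (Metric.ball 0 r))
    (happ : ∀ z ∈ Metric.ball (0 : ℂ) r, ‖f z - (α + β * z ^ m)‖ ≤ η)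
    (hη : 32 * η < ‖α‖) (hα : α ≠ 0) (hαβ : 2 * ‖α‖ ≤ ‖β‖ * r ^ m)
    (hζ : α + β * ζ ^ m = 0) :
    ∃ z ∈ Metric.closedBall ζ (‖ζ‖ / (4 * m)), f z = 0 ∧ ‖z‖ ≤ r := by
  have hm' : (0 : ℝ) < m := by exact_mod_cast hm
  have hαn : 0 < ‖α‖ := norm_pos_iff.2 hα
  have hζ0 : ζ ≠ 0 := by
    rintro rfl
    rw [zero_pow hm.ne', mul_zero, add_zero] at hζ
    exact hα hζ
  have hζn : 0 < ‖ζ‖ := norm_pos_iff.2 hζ0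
  have hβζ : ‖β‖ * ‖ζ‖ ^ m = ‖α‖ := by
    rw [← norm_pow, ← norm_mul, eq_neg_of_add_eq_zero_right hζ, norm_neg]
  have hβn : 0 < ‖β‖ := by
    refine lt_of_le_of_ne (norm_nonneg _) fun h => ?_
    rw [← h, zero_mul] at hβζ
    linarith
  -- On the circle of this radius the relative displacement u satisfies m‖u‖ = 1/4. The disk stays
  -- inside radius r because (1 + 1/(4m))^m < 2 and ‖β‖ r^m ≥ 2‖α‖.
  set s := ‖ζ‖ / (4 * m) with hs
  have hs0 : 0 < s := by positivity
  have hsub : Metric.closedBall ζ s ⊆ Metric.ball (0 : ℂ) r := by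
    intro z hz
    rw [Metric.mem_closedBall, dist_eq_norm] at hz
    rw [Metric.mem_ball, dist_zero_right]
    have h1 : ‖z‖ ≤ ‖ζ‖ * (1 + 1 / (4 * m)) := by
      have := norm_sub_norm_le z ζ
      calc ‖z‖ ≤ ‖ζ‖ + s := by linarith
        _ = _ := by rw [hs]; ring
    refine h1.trans_lt (lt_of_pow_lt_pow_left₀ m hr.le ?_)
    have h2 : (1 + 1 / (4 * (m : ℝ))) ^ m < 2 := by
      calc (1 + 1 / (4 * (m : ℝ))) ^ m ≤ Real.exp (1 / (4 * (m : ℝ))) ^ m := by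
            gcongr
            linarith [Real.add_one_le_exp (1 / (4 * (m : ℝ)))]
        _ = Real.exp (1 / 4) := by
            rw [← Real.exp_nat_mul]
            congr 1
            field_simp
        _ < Real.exp (Real.log 2) := by
            apply Real.exp_lt_exp.2
            linarith [Real.log_two_gt_d9]
        _ = 2 := Real.exp_log (by norm_num)
    rw [mul_pow]
    have h3 : ‖β‖ * (‖ζ‖ ^ m * (1 + 1 / (4 * (m : ℝ))) ^ m) < ‖β‖ * r ^ m := by
      rw [← mul_assoc, hβζ]
      nlinarith
    exact lt_of_mul_lt_mul_left h3 hβn.le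
  have hζmem : ζ ∈ Metric.ball (0 : ℂ) r := hsub (Metric.mem_closedBall_self hs0.le)
  have hfζ : ‖f ζ‖ ≤ η := by simpa [hζ] using happ ζ hζmem
  have hsph : ∀ z ∈ Metric.sphere ζ s, ‖α‖ / 8 - 2 * η ≤ ‖f z - f ζ‖ := by
    intro z hz
    have hzb := hsub (Metric.sphere_subset_closedBall hz)
    rw [mem_sphere_iff_norm] at hz
    set u := (z - ζ) / ζ with hu
    have hun : m * ‖u‖ = 1 / 4 := by
      rw [hu, norm_div, hz, hs]
      field_simp
    have hlow := half_mul_norm_le_norm_one_add_pow_sub_one (u := u) (m := m) (by rw [hun]; norm_num)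
    rw [hun] at hlow
    have hz' : z = ζ * (1 + u) := by rw [hu]; field_simp; ring
    have hval : ‖α + β * z ^ m‖ = ‖α‖ * ‖(1 + u) ^ m - 1‖ := by
      have : α + β * z ^ m = β * ζ ^ m * ((1 + u) ^ m - 1) := by
        rw [hz', mul_pow]
        linear_combination hζ
      rw [this, norm_mul, norm_mul, norm_pow, hβζ]
    have h1 : ‖α‖ / 8 ≤ ‖α + β * z ^ m‖ := by
      rw [hval]
      nlinarith
    have h2 := happ z hzb
    have h3 : ‖α + β * z ^ m‖ ≤ ‖f z - f ζ‖ + ‖f ζ‖ + ‖f z - (α + β * z ^ m)‖ := by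
      calc ‖α + β * z ^ m‖ = ‖(f z - f ζ) + f ζ - (f z - (α + β * z ^ m))‖ := by congr 1; ring
        _ ≤ _ := (norm_sub_le _ _).trans (by gcongr; exact norm_add_le _ _)
    linarith
  have hη0 : 0 ≤ η := (norm_nonneg _).trans hfζ
  have hfreq : ∃ᶠ z in nhds ζ, f z ≠ f ζ := by
    intro hev
    have hev' : f =ᶠ[nhds ζ] fun _ => f ζ := by
      filter_upwards [hev] with z hz using not_not.1 hz
    have han : AnalyticOnNhd ℂ f (Metric.ball 0 r) := hf.analyticOnNhd Metric.isOpen_ball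
    have heq := han.eqOn_of_preconnected_of_eventuallyEq (g := fun _ => f ζ) analyticOnNhd_const
      (convex_ball (0 : ℂ) r).isPreconnected hζmem hev'
    have hsp : ζ + s ∈ Metric.sphere ζ s := by
      rw [mem_sphere_iff_norm]
      simp [abs_of_pos hs0]
    have h1 := hsph _ hsp
    rw [heq (hsub (Metric.sphere_subset_closedBall hsp)), sub_self, norm_zero] at h1
    linarith
  -- The quantitative open mapping theorem covers the disk of radius (‖α‖/8 - 2η)/2 about f ζ. It
  -- contains 0 because ‖f ζ‖ ≤ η and 32η < ‖α‖.
  have himg := (hf.diffContOnCl_ball hsub).ball_subset_image_closedBall hs0 hsph hfreq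
  obtain ⟨z, hz, hz0⟩ := himg (show (0 : ℂ) ∈ _ by
    rw [Metric.mem_ball, dist_zero_left]
    linarith)
  refine ⟨z, hz, hz0, ?_⟩
  have := hsub hz
  rw [Metric.mem_ball, dist_zero_right] at this
  exact this.le

/-- A small perturbation of `α + β z ^ m` has at least `m` distinct zeros. -/
theorem le_encard_zeros_of_near_binomial {f : ℂ → ℂ} {r η : ℝ} {α β : ℂ} {m : ℕ} (hm : 0 < m)
    (hr : 0 < r) (hf : DifferentiableOn ℂ f (Metric.ball 0 r))
    (happ : ∀ z ∈ Metric.ball (0 : ℂ) r, ‖f z - (α + β * z ^ m)‖ ≤ η)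
    (hη : 32 * η < ‖α‖) (hα : α ≠ 0) (hαβ : 2 * ‖α‖ ≤ ‖β‖ * r ^ m) :
    (m : ℕ∞) ≤ {z : ℂ | f z = 0 ∧ ‖z‖ ≤ r}.encard := by
  have hm' : (0 : ℝ) < m := by exact_mod_cast hm
  have hβ : β ≠ 0 := by
    rintro rfl
    have := norm_pos_iff.2 hα
    rw [norm_zero, zero_mul] at hαβ
    linarith
  obtain ⟨w, hw⟩ := IsAlgClosed.exists_pow_nat_eq (-α / β) hm
  have hw0 : w ≠ 0 := by
    rintro rfl
    rw [zero_pow hm.ne'] at hw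
    exact div_ne_zero (neg_ne_zero.2 hα) hβ hw.symm
  set ω := Complex.exp (2 * Real.pi * Complex.I / m) with hω
  have hprim : IsPrimitiveRoot ω m := Complex.isPrimitiveRoot_exp m hm.ne'
  have hωn : ‖ω‖ = 1 := hprim.norm'_eq_one hm.ne'
  have hroot : ∀ k : ℕ, α + β * (w * ω ^ k) ^ m = 0 := by
    intro k
    rw [mul_pow, hw, ← pow_mul, mul_comm k m, pow_mul, hprim.pow_eq_one, one_pow]
    field_simp
    ring
  choose Z hZ1 hZ2 using fun k : Fin m =>
    exists_zero_near_root hm hr hf happ hη hα hαβ (hroot k)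
  have hnorm : ∀ k : ℕ, ‖w * ω ^ k‖ = ‖w‖ := fun k => by simp [hωn]
  -- A common zero puts two roots so close that their relative displacement u has m‖u‖ ≤ 1/2. Then
  -- (1 + u)^m = 1 forces u = 0.
  have hinj : Function.Injective Z := by
    intro j k hjk
    have h1 := hZ1 j
    have h2 := hZ1 k
    rw [← hjk] at h2
    rw [Metric.mem_closedBall, hnorm] at h1 h2
    have hd : ‖w * ω ^ (j : ℕ) - w * ω ^ (k : ℕ)‖ ≤ ‖w‖ / (2 * m) := by
      rw [← dist_eq_norm]
      calc dist (w * ω ^ (j : ℕ)) (w * ω ^ (k : ℕ))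
          ≤ dist (Z j) (w * ω ^ (j : ℕ)) + dist (Z j) (w * ω ^ (k : ℕ)) := dist_triangle_left _ _ _
        _ ≤ ‖w‖ / (4 * m) + ‖w‖ / (4 * m) := add_le_add h1 h2
        _ = _ := by field_simp; norm_num
    set ζ := w * ω ^ (k : ℕ) with hζ
    have hζ0 : ζ ≠ 0 := norm_pos_iff.1 (by rw [hζ, hnorm]; exact norm_pos_iff.2 hw0)
    have hζn : ‖ζ‖ = ‖w‖ := hnorm k
    set u := (w * ω ^ (j : ℕ) - ζ) / ζ with hu
    have hun : m * ‖u‖ ≤ 1 / 2 := by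
      rw [hu, norm_div, hζn]
      have hwp : 0 < ‖w‖ := norm_pos_iff.2 hw0
      calc m * (‖w * ω ^ (j : ℕ) - ζ‖ / ‖w‖) ≤ m * (‖w‖ / (2 * m) / ‖w‖) := by gcongr
        _ = 1 / 2 := by field_simp
    have hlow := half_mul_norm_le_norm_one_add_pow_sub_one hun
    have hone : (1 + u) ^ m = 1 := by
      have h3 : ζ * (1 + u) = w * ω ^ (j : ℕ) := by rw [hu]; field_simp; ring
      have h4 : β * ζ ^ m * (1 + u) ^ m = β * ζ ^ m := by
        have := congrArg (fun x => β * x ^ m) h3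
        simp only [mul_pow ζ] at this
        linear_combination this + hroot j - hroot k
      have h5 : β * ζ ^ m ≠ 0 := mul_ne_zero hβ (pow_ne_zero _ hζ0)
      exact mul_left_cancel₀ h5 (h4.trans (mul_one _).symm)
    rw [hone, sub_self, norm_zero] at hlow
    have hu0 : ‖u‖ = 0 := by
      have := norm_nonneg u
      by_contra h
      have : 0 < ‖u‖ := lt_of_le_of_ne this (Ne.symm h)
      have : 0 < m * ‖u‖ / 2 := by positivity
      linarith
    have hu1 : w * ω ^ (j : ℕ) = w * ω ^ (k : ℕ) := by
      rw [norm_eq_zero, hu, div_eq_zero_iff] at hu0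
      exact sub_eq_zero.1 (hu0.resolve_right hζ0)
    exact Fin.ext (hprim.pow_inj j.2 k.2 (mul_left_cancel₀ hw0 hu1))
  calc (m : ℕ∞) = (Set.range Z).encard := by
        rw [← Set.image_univ, hinj.encard_image, Set.encard_univ]
        simp
    _ ≤ _ := Set.encard_le_encard (by rintro _ ⟨k, rfl⟩; exact hZ2 k)

/-! ### Probabilities of coefficient events -/

theorem gaussianSeqLaw_head_tail {K : ℕ} (s : Fin K → Set ℂ) (hs : ∀ k, MeasurableSet (s k))
    {T : Set (ℕ → ℂ)} (hT : MeasurableSet T) :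
    MeasurableSet {x : ℕ → ℂ | (∀ k : Fin K, x k ∈ s k) ∧ (fun j => x (K + j)) ∈ T} ∧
    gaussianSeqLaw {x | (∀ k : Fin K, x k ∈ s k) ∧ (fun j => x (K + j)) ∈ T} =
      (∏ k, stdComplexGaussian (s k)) * gaussianSeqLaw T := by
  have hm : MeasurableSet {x : ℕ → ℂ | (∀ k : Fin K, x k ∈ s k) ∧ (fun j => x (K + j)) ∈ T} := by
    refine MeasurableSet.inter (s₁ := {x : ℕ → ℂ | ∀ k : Fin K, x k ∈ s k}) ?_ ?_
    · rw [show {x : ℕ → ℂ | ∀ k : Fin K, x k ∈ s k} = ⋂ k : Fin K, (fun x => x k) ⁻¹' s k by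
        ext; simp]
      exact MeasurableSet.iInter fun k => (measurable_pi_apply _) (hs k)
    · exact (measurable_pi_iff.2 fun j => measurable_pi_apply (K + j)) hT
  refine ⟨hm, ?_⟩
  rw [← (measurePreserving_appendSeq K).measure_preimage hm.nullMeasurableSet,
    ← Measure.pi_pi, ← Measure.prod_prod]
  congr 1
  ext ⟨x, y⟩
  simp [appendSeq_fin, appendSeq_add]

/-- Union bound; (n + 1)² ≥ 1 + 2n turns the Gaussian tails into a geometric series of ratio at most
1/2. -/
theorem gaussianSeqLaw_exists_norm_gt_le {t : ℝ} (ht : 1 ≤ t) :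
    gaussianSeqLaw {x | ∃ n : ℕ, t * (n + 1) < ‖x n‖} ≤ ENNReal.ofReal (4 * Real.exp (-t ^ 2 / 2)) := by
  have h1 : {x : ℕ → ℂ | ∃ n : ℕ, t * (n + 1) < ‖x n‖} = ⋃ n : ℕ, {x | x n ∈ {z : ℂ | t * (n + 1) < ‖z‖}} := by
    ext; simp
  have he : Real.exp (-t ^ 2) ≤ 1 / 2 := by
    have h2 : Real.exp (-t ^ 2) ≤ Real.exp (-1) := Real.exp_le_exp.2 (by nlinarith)
    linarith [Real.exp_neg_one_lt_half]
  have he0 := Real.exp_pos (-t ^ 2)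
  have hgeo : HasSum (fun n : ℕ => 2 * Real.exp (-t ^ 2 / 2) * Real.exp (-t ^ 2) ^ n)
      (2 * Real.exp (-t ^ 2 / 2) * (1 - Real.exp (-t ^ 2))⁻¹) :=
    (hasSum_geometric_of_lt_one he0.le (by linarith)).mul_left _
  rw [h1]
  calc gaussianSeqLaw (⋃ n : ℕ, {x | x n ∈ {z : ℂ | t * (n + 1) < ‖z‖}})
      ≤ ∑' n : ℕ, gaussianSeqLaw {x | x n ∈ {z : ℂ | t * (n + 1) < ‖z‖}} := measure_iUnion_le _
    _ ≤ ∑' n : ℕ, ENNReal.ofReal (2 * Real.exp (-t ^ 2 / 2) * Real.exp (-t ^ 2) ^ n) := by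
        refine ENNReal.tsum_le_tsum fun n => ?_
        rw [gaussianSeqLaw_eval n (measurableSet_lt measurable_const measurable_norm)]
        refine (stdComplexGaussian_norm_gt_le _ (by positivity)).trans
          (ENNReal.ofReal_le_ofReal ?_)
        rw [← Real.exp_nat_mul, mul_assoc, ← Real.exp_add]
        gcongr
        nlinarith [mul_nonneg (sq_nonneg t) (sq_nonneg (n : ℝ))]
    _ = ENNReal.ofReal (2 * Real.exp (-t ^ 2 / 2) * (1 - Real.exp (-t ^ 2))⁻¹) := by
        rw [← ENNReal.ofReal_tsum_of_nonneg (fun n => by positivity) hgeo.summable, hgeo.tsum_eq]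
    _ ≤ _ := by
        apply ENNReal.ofReal_le_ofReal
        have : (1 - Real.exp (-t ^ 2))⁻¹ ≤ 2 := by
          rw [inv_le_comm₀ (by linarith) (by norm_num)]
          linarith
        nlinarith [Real.exp_pos (-t ^ 2 / 2)]

theorem measurableSet_norm_le_linear (t : ℝ) :
    MeasurableSet {x : ℕ → ℂ | ∀ n : ℕ, ‖x n‖ ≤ t * (n + 1)} := by
  rw [show {x : ℕ → ℂ | ∀ n : ℕ, ‖x n‖ ≤ t * (n + 1)} = ⋂ n : ℕ, {x | ‖x n‖ ≤ t * (n + 1)} by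
    ext; simp]
  exact MeasurableSet.iInter fun n => measurableSet_le (by fun_prop) measurable_const

theorem half_le_gaussianSeqLaw_norm_le_linear :
    ENNReal.ofReal (1 / 2) ≤ gaussianSeqLaw {x | ∀ n : ℕ, ‖x n‖ ≤ 3 * (n + 1)} := by
  have hm := measurableSet_norm_le_linear 3
  have h1 := gaussianSeqLaw_exists_norm_gt_le (t := 3) (by norm_num)
  have h2 : {x : ℕ → ℂ | ∃ n : ℕ, 3 * ((n : ℝ) + 1) < ‖x n‖}
      = {x | ∀ n : ℕ, ‖x n‖ ≤ 3 * (n + 1)}ᶜ := by ext; simp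
  rw [h2] at h1
  have h3 := prob_add_prob_compl (μ := gaussianSeqLaw) hm
  have h4 : ENNReal.ofReal (4 * Real.exp (-3 ^ 2 / 2)) ≤ ENNReal.ofReal (1 / 2) := by
    apply ENNReal.ofReal_le_ofReal
    have : Real.exp (-3 ^ 2 / 2) ≤ Real.exp (-1) ^ 4 := by
      rw [← Real.exp_nat_mul]
      exact Real.exp_le_exp.2 (by norm_num)
    have h5 : Real.exp (-1) ^ 4 ≤ (1 / 2) ^ 4 :=
      pow_le_pow_left₀ (Real.exp_pos _).le Real.exp_neg_one_lt_half.le 4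
    linarith
  have h6 : (1 : ℝ≥0∞) = ENNReal.ofReal (1 / 2) + ENNReal.ofReal (1 / 2) := by
    rw [← ENNReal.ofReal_add (by norm_num) (by norm_num)]
    norm_num
  by_contra! hlt
  have : gaussianSeqLaw {x : ℕ → ℂ | ∀ n : ℕ, ‖x n‖ ≤ 3 * (n + 1)} +
      gaussianSeqLaw {x : ℕ → ℂ | ∀ n : ℕ, ‖x n‖ ≤ 3 * (n + 1)}ᶜ < 1 := by
    conv_rhs => rw [h6]
    exact ENNReal.add_lt_add_of_lt_of_le (by finiteness) hlt (h1.trans h4)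
  exact this.ne h3

/-! ### Forcing many zeros: the lower bound on the probability -/

/-- If the coefficients of index `0` and `m` dominate all the others, there are at least `m` zeros. -/
theorem le_zeroCount_of_dominating {L : ℝ} (hL : 0 < L) {p : ℕ} (hp : L ≤ p) {r q ε : ℝ} {m : ℕ}
    (hm : 0 < m) (hr0 : 0 < r) (hr1 : r < 1) (hq : q = hypCoeff L m * r ^ m)
    (hε0 : 0 ≤ ε) (hε1 : ε ≤ 1)
    (hε : (2 * m + 1 : ℝ) * (ε * (2 * m + 1 : ℝ) ^ p) ≤ q / 600)
    (htail : ∑' j : ℕ, 3 * ((((2 * m + 1 + j : ℕ) : ℝ) + 1) ^ (p + 1) * r ^ (2 * m + 1 + j))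
      ≤ q / 600) {x : ℕ → ℂ} (hx0 : q / 8 ≤ ‖x 0‖) (hx0' : ‖x 0‖ ≤ 3 * q / 8)
    (hq1 : q ≤ 1)
    (hxm : 1 ≤ ‖x m‖) (hxm' : ‖x m‖ ≤ 2) (hx : ∀ n ≤ 2 * m, n ≠ 0 → n ≠ m → ‖x n‖ ≤ ε)
    (hxt : ∀ j : ℕ, ‖x (2 * m + 1 + j)‖ ≤ 3 * (j + 1)) :
    (m : ℕ∞) ≤ zeroCount L x r := by
  have hb := hypCoeff_pos hL m
  have hq0 : 0 < q := by rw [hq]; positivity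
  have hgrow : ∀ n, ‖x n‖ ≤ 3 * ((n : ℝ) + 1) := by
    intro n
    have hn : (0 : ℝ) ≤ n := n.cast_nonneg
    by_cases h2 : n ≤ 2 * m
    · by_cases h0 : n = 0
      · subst h0; linarith
      · by_cases h1 : n = m
        · subst h1; linarith
        · linarith [hx n h2 h0 h1]
    · obtain ⟨j, rfl⟩ := Nat.exists_eq_add_of_le (show 2 * m + 1 ≤ n by omega)
      refine (hxt j).trans ?_
      push_cast
      linarith [m.cast_nonneg (α := ℝ)]
  -- The middle block and the tail contribute q/600 each, and 32 · q/300 < q/8 ≤ ‖x 0‖. Also 2‖x 0‖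
  -- ≤ 3q/4, below ‖β‖ r^m ≥ q.
  refine le_encard_zeros_of_near_binomial (f := hypGAF L x) (η := q / 300) (α := x 0)
    (β := x m * (hypCoeff L m : ℂ)) hm hr0
    ((differentiableOn_hypGAF hL hgrow).mono (Metric.ball_subset_ball hr1.le)) ?_ (by linarith)
    (norm_pos_iff.1 (by linarith)) ?_
  · intro z hz
    rw [Metric.mem_ball, dist_zero_right] at hz
    set a : ℕ → ℂ := fun n => x n * (hypCoeff L n : ℂ) * z ^ n with ha
    have hs : Summable fun n => ‖a n‖ := summable_hypGAF hL hgrow (hz.trans hr1)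
    have hsplit : hypGAF L x z = ∑ n ∈ Finset.range (2 * m + 1), a n
        + ∑' j, a (2 * m + 1 + j) := by
      rw [hypGAF, ← hs.of_norm.sum_add_tsum_nat_add (2 * m + 1)]
      simp only [add_comm]
    have hhead : ∑ n ∈ Finset.range (2 * m + 1), a n
        = x 0 + x m * (hypCoeff L m : ℂ) * z ^ m +
          ∑ n ∈ ((Finset.range (2 * m + 1)).erase 0).erase m, a n := by
      rw [← Finset.add_sum_erase _ a (show 0 ∈ Finset.range (2 * m + 1) by simp),
        ← Finset.add_sum_erase _ a (show m ∈ (Finset.range (2 * m + 1)).erase 0 by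
          simp; omega)]
      simp [ha, hypCoeff_zero, add_assoc]
    have hmid : ‖∑ n ∈ ((Finset.range (2 * m + 1)).erase 0).erase m, a n‖ ≤ q / 600 := by
      refine (norm_sum_le_of_le _ (f := a) (n := fun _ => ε * (2 * m + 1 : ℝ) ^ p) ?_).trans ?_
      · intro n hn
        simp only [Finset.mem_erase, Finset.mem_range] at hn
        have hn2 : (n : ℝ) ≤ 2 * m := by exact_mod_cast (by omega : n ≤ 2 * m)
        rw [ha, norm_mul, norm_mul, norm_pow, Complex.norm_real,
          Real.norm_of_nonneg (hypCoeff_nonneg L n)]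
        calc ‖x n‖ * hypCoeff L n * ‖z‖ ^ n ≤ ε * (2 * m + 1 : ℝ) ^ p * 1 := by
              refine mul_le_mul ?_ (pow_le_one₀ (norm_nonneg z) (hz.trans hr1).le)
                (by positivity) (by positivity)
              refine mul_le_mul (hx n (by omega) hn.2.1 hn.1) ?_ (hypCoeff_nonneg L n) hε0
              exact (hypCoeff_le hL hp n).trans (by gcongr)
          _ = _ := mul_one _
      · rw [Finset.sum_const, nsmul_eq_mul]
        refine le_trans ?_ hε
        gcongr
        have : (((Finset.range (2 * m + 1)).erase 0).erase m).card ≤ 2 * m + 1 := by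
          refine (Finset.card_erase_le).trans ((Finset.card_erase_le).trans ?_)
          simp
        exact_mod_cast this
    have htl : ‖∑' j, a (2 * m + 1 + j)‖ ≤ q / 600 := by
      refine le_trans (tsum_of_norm_bounded (Summable.hasSum ?_) fun j => ?_) htail
      · refine Summable.mul_left 3 ?_
        have := (summable_pow_mul_geometric_succ (p + 1) hr0.le hr1).1
        have h2 := (summable_nat_add_iff (2 * m + 1)).2 this
        simpa only [add_comm] using h2
      · exact norm_hypGAF_term_le hL hp (by norm_num) hgrow hz.le _
    rw [hsplit, hhead]
    have : x 0 + x m * (hypCoeff L m : ℂ) * z ^ m +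
        ∑ n ∈ ((Finset.range (2 * m + 1)).erase 0).erase m, a n + ∑' j, a (2 * m + 1 + j)
        - (x 0 + x m * (hypCoeff L m : ℂ) * z ^ m)
        = ∑ n ∈ ((Finset.range (2 * m + 1)).erase 0).erase m, a n + ∑' j, a (2 * m + 1 + j) := by
      ring
    rw [this]
    refine (norm_add_le _ _).trans ?_
    linarith
  · rw [norm_mul, Complex.norm_real, Real.norm_of_nonneg hb.le, mul_assoc, ← hq]
    nlinarith

theorem exp_neg_mul_log_natCast_le {δ D x : ℝ} {n E : ℕ} (hn : 0 < n)
    (h : E * Real.log n ≤ x) (hx : x ≤ δ * D) : Real.exp (-(δ * D)) ≤ 1 / (n : ℝ) ^ E := by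
  have hn' : (0 : ℝ) < n := by exact_mod_cast hn
  calc Real.exp (-(δ * D)) ≤ Real.exp (-(E * Real.log n)) := Real.exp_le_exp.2 (by linarith)
    _ = 1 / (n : ℝ) ^ E := by
      rw [Real.exp_neg, Real.exp_nat_mul, Real.exp_log hn', one_div]

/-- Beyond index 2m, n - m ≥ n/2, so r^(n-m) ≤ exp(-δn/2) ≤ n^(-p-5). After the polynomial factor
n^(-4) remains: half of it gives (m + 1)^(-2), half makes the sum over j converge. This is why the
coefficients are controlled up to 2m rather than m. -/
theorem tsum_tail_le {r δ : ℝ} {m p : ℕ} (hr : r = 1 - δ) (hδ0 : 0 < δ) (hδ1 : δ ≤ 1 / 2)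
    (hlog : ∀ n : ℕ, m ≤ n → (2 * (p + 5) : ℝ) * Real.log n ≤ δ * n) :
    ∑' j : ℕ, 3 * ((((2 * m + 1 + j : ℕ) : ℝ) + 1) ^ (p + 1) * r ^ (2 * m + 1 + j))
      ≤ 3 * 2 ^ (p + 1) * r ^ m / ((m : ℝ) + 1) ^ 2 * ∑' j : ℕ, 1 / ((j : ℝ) + 1) ^ 2 := by
  have hr0 : 0 < r := by linarith
  have hr1 : r < 1 := by linarith
  have hs : Summable fun j : ℕ => 1 / ((j : ℝ) + 1) ^ 2 := by
    have := (summable_nat_add_iff 1).2 (Real.summable_one_div_nat_pow.2 (by norm_num : 1 < 2))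
    simpa using this
  rw [← tsum_mul_left]
  have hle : ∀ j : ℕ, 3 * ((((2 * m + 1 + j : ℕ) : ℝ) + 1) ^ (p + 1) * r ^ (2 * m + 1 + j)) ≤
      3 * 2 ^ (p + 1) * r ^ m / ((m : ℝ) + 1) ^ 2 * (1 / ((j : ℝ) + 1) ^ 2) := by
    intro j
    set n : ℕ := 2 * m + 1 + j with hn
    have hn1 : (1 : ℝ) ≤ n := by exact_mod_cast (by omega : 1 ≤ n)
    have hnm : (m : ℝ) + 1 ≤ n := by exact_mod_cast (by omega : m + 1 ≤ n)
    have hnj : (j : ℝ) + 1 ≤ n := by exact_mod_cast (by omega : j + 1 ≤ n)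
    have h1 : r ^ n ≤ r ^ m * (1 / (n : ℝ) ^ (p + 5)) := by
      rw [show n = m + (n - m) by omega, pow_add, ← show n = m + (n - m) by omega]
      gcongr
      have h2 : r ≤ Real.exp (-δ) := by linarith [Real.add_one_le_exp (-δ)]
      calc r ^ (n - m) ≤ Real.exp (-δ) ^ (n - m) := by gcongr
        _ = Real.exp (-(δ * (n - m : ℕ))) := by rw [← Real.exp_nat_mul]; congr 1; ring
        _ ≤ 1 / (n : ℝ) ^ (p + 5) := by
          refine exp_neg_mul_log_natCast_le (x := δ * n / 2) (by omega) ?_ ?_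
          · have := hlog n (by omega)
            push_cast
            linarith
          · rw [Nat.cast_sub (by omega)]
            have : (2 * m : ℝ) ≤ n := by exact_mod_cast (by omega : 2 * m ≤ n)
            nlinarith
    calc 3 * (((n : ℝ) + 1) ^ (p + 1) * r ^ n)
        ≤ 3 * ((2 * n : ℝ) ^ (p + 1) * (r ^ m * (1 / (n : ℝ) ^ (p + 5)))) := by
          gcongr
          linarith
      _ = 3 * 2 ^ (p + 1) * r ^ m * (1 / (n : ℝ) ^ 2 * (1 / (n : ℝ) ^ 2)) := by
          field_simp
          ring
      _ ≤ 3 * 2 ^ (p + 1) * r ^ m * (1 / ((m : ℝ) + 1) ^ 2 * (1 / ((j : ℝ) + 1) ^ 2)) := by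
          gcongr
      _ = _ := by ring
  exact (Summable.of_nonneg_of_le (fun j => by positivity) hle (hs.mul_left _)).tsum_le_tsum hle
    (hs.mul_left _)

theorem exp_neg_two_mul_le_one_sub {δ : ℝ} (hδ0 : 0 ≤ δ) (hδ1 : δ ≤ 1 / 2) :
    Real.exp (-(2 * δ)) ≤ 1 - δ := by
  have h1 : 1 + 2 * δ ≤ Real.exp (2 * δ) := by linarith [Real.add_one_le_exp (2 * δ)]
  rw [Real.exp_neg, inv_le_comm₀ (Real.exp_pos _) (by linarith)]
  refine le_trans ?_ h1
  rw [inv_le_iff_one_le_mul₀ (by linarith)]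
  nlinarith

theorem div_mul_pow_le_hypCoeff_mul_pow {L : ℝ} (hL : 0 < L) {r : ℝ} (hr : 0 ≤ r) (m : ℕ) :
    min L 1 / ((m : ℝ) + 1) * r ^ m ≤ hypCoeff L m * r ^ m := by
  have hc : 0 < min L 1 := lt_min hL one_pos
  have hle : min L 1 / ((m : ℝ) + 1) ≤ hypCoeff L m := by
    have h1 := le_hypCoeff_sq hL m
    have h0 : 0 < min L 1 / ((m : ℝ) + 1) := by positivity
    have h2 : min L 1 / ((m : ℝ) + 1) ≤ 1 := by
      rw [div_le_one (by positivity)]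
      exact (min_le_right _ _).trans (by linarith [m.cast_nonneg (α := ℝ)])
    refine le_of_sq_le_sq ?_ (hypCoeff_nonneg L m)
    nlinarith
  gcongr

theorem hypCoeff_mul_pow_le_one {L : ℝ} (hL : 0 < L) {p : ℕ} (hp : L ≤ p) {r δ : ℝ} {m : ℕ}
    (hr : r = 1 - δ) (hδ1 : δ ≤ 1 / 2) (hmpos : 0 < m) (hm : (2 : ℝ) ^ p ≤ m)
    (hlog : (2 * (p + 5) : ℝ) * Real.log m ≤ δ * m) : hypCoeff L m * r ^ m ≤ 1 := by
  have hr0 : 0 < r := by linarith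
  have hp0 : (0 : ℝ) ≤ p := p.cast_nonneg
  have hm1 : (1 : ℝ) ≤ m := by exact_mod_cast hmpos
  have h1 : r ^ m ≤ 1 / (m : ℝ) ^ (p + 5) := by
    calc r ^ m ≤ Real.exp (-δ) ^ m := by
          gcongr
          linarith [Real.add_one_le_exp (-δ)]
      _ = Real.exp (-(δ * m)) := by rw [← Real.exp_nat_mul]; congr 1; ring
      _ ≤ _ := by
        refine exp_neg_mul_log_natCast_le hmpos ?_ (hlog)
        push_cast
        have h1 : 0 ≤ Real.log m := Real.log_natCast_nonneg m
        nlinarith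
  calc hypCoeff L m * r ^ m ≤ ((m : ℝ) + 1) ^ p * (1 / (m : ℝ) ^ (p + 5)) := by
        gcongr
        exact hypCoeff_le hL hp m
    _ ≤ (2 * m : ℝ) ^ p * (1 / (m : ℝ) ^ (p + 5)) := by
        gcongr
        linarith
    _ = 2 ^ p / (m : ℝ) ^ 5 := by field_simp; ring
    _ ≤ 1 := by
        rw [div_le_one (by positivity)]
        calc (2 : ℝ) ^ p ≤ m := hm
          _ ≤ (m : ℝ) ^ 5 := le_self_pow₀ hm1 (by norm_num)

/-- Since m ≤ exp(δm) and 1 ≤ δm, each factor is absorbed into the exponent. The 11 is 2 + 2 + 7,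
from m + 1, r^m and 600; each 2m + 1 costs 3. -/
theorem exp_neg_le_div_mul_pow_div {c r δ : ℝ} {m p : ℕ} (hc0 : 0 < c) (hc1 : c ≤ 1)
    (hr : r = 1 - δ) (hδ0 : 0 < δ) (hδ1 : δ ≤ 1 / 2) (h6 : (3 : ℝ) ≤ m) (hδm : 1 ≤ δ * m)
    (hlogm : Real.log m ≤ δ * m) :
    Real.exp (-((-Real.log c + 11 + 3 * (p + 1)) * (δ * m))) ≤
      c / ((m : ℝ) + 1) * r ^ m / (600 * (2 * m + 1 : ℝ) ^ (p + 1)) := by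
  have hp0 : (0 : ℝ) ≤ p := p.cast_nonneg
  have hr0 : 0 < r := by linarith
  set k₀ := -Real.log c with hk₀
  have hk₀0 : 0 ≤ k₀ := by
    have := Real.log_nonpos hc0.le hc1
    linarith
  have hmexp : (m : ℝ) ≤ Real.exp (δ * m) := by
    calc (m : ℝ) = Real.exp (Real.log m) := (Real.exp_log (by linarith)).symm
      _ ≤ _ := Real.exp_le_exp.2 hlogm
  have e1 : Real.exp (-k₀) = c := by rw [hk₀, neg_neg, Real.exp_log hc0]
  have e2 : Real.exp (-(2 * δ * m)) ≤ r ^ m := by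
    calc Real.exp (-(2 * δ * m)) = Real.exp (-(2 * δ)) ^ m := by
          rw [← Real.exp_nat_mul]; congr 1; ring
      _ ≤ r ^ m := by
          rw [hr]
          exact pow_le_pow_left₀ (Real.exp_pos _).le (exp_neg_two_mul_le_one_sub hδ0.le hδ1) m
  have e3 : (2 * m + 1 : ℝ) ≤ Real.exp (3 * (δ * m)) := by
    have h7 : Real.exp (3 * (δ * m)) = Real.exp (δ * m) ^ 3 := by
      rw [← Real.exp_nat_mul]; norm_num
    rw [h7]
    calc (2 * m + 1 : ℝ) ≤ m ^ 3 := by nlinarith [mul_nonneg (by linarith : (0 : ℝ) ≤ m) (sq_nonneg ((m : ℝ) - 3)), sq_nonneg ((m : ℝ) - 3)]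
      _ ≤ _ := by gcongr
  have e4 : (m : ℝ) + 1 ≤ Real.exp (2 * (δ * m)) := by
    have h7 : Real.exp (2 * (δ * m)) = Real.exp (δ * m) ^ 2 := by
      rw [← Real.exp_nat_mul]; norm_num
    rw [h7]
    calc (m + 1 : ℝ) ≤ m ^ 2 := by nlinarith
      _ ≤ _ := by gcongr
  have e5 : (600 : ℝ) ≤ Real.exp 7 := by
    have h1 : Real.exp 7 = Real.exp 1 ^ 7 := by rw [← Real.exp_nat_mul]; norm_num
    rw [h1]
    calc (600 : ℝ) ≤ 2.7 ^ 7 := by norm_num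
      _ ≤ Real.exp 1 ^ 7 := by
        gcongr
        linarith [Real.exp_one_gt_d9]
  have e6 : (2 * m + 1 : ℝ) ^ (p + 1) ≤ Real.exp (3 * (p + 1) * (δ * m)) := by
    calc (2 * m + 1 : ℝ) ^ (p + 1) ≤ Real.exp (3 * (δ * m)) ^ (p + 1) := by gcongr
      _ = _ := by rw [← Real.exp_nat_mul]; push_cast; congr 1; ring
  calc Real.exp (-((k₀ + 11 + 3 * (p + 1)) * (δ * m)))
      ≤ Real.exp (-k₀ - 2 * (δ * m) - 2 * δ * m - 7 - 3 * (p + 1) * (δ * m)) := by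
        apply Real.exp_le_exp.2
        nlinarith [mul_le_mul_of_nonneg_left hδm hk₀0]
    _ = Real.exp (-k₀) / Real.exp (2 * (δ * m)) * Real.exp (-(2 * δ * m)) /
          (Real.exp 7 * Real.exp (3 * (p + 1) * (δ * m))) := by
        rw [← Real.exp_add, ← Real.exp_sub, ← Real.exp_add, ← Real.exp_sub]
        congr 1
        ring
    _ ≤ c / ((m : ℝ) + 1) * r ^ m / (600 * (2 * m + 1 : ℝ) ^ (p + 1)) := by
        rw [e1]
        gcongr

/-- Probability that the first `K` coefficients lie in prescribed small disks while all the others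
grow at most linearly. -/
theorem le_gaussianSeqLaw_disks {ε : ℝ} (hε : 0 ≤ ε) (K : ℕ) (ctr : ℕ → ℂ) (rad : ℕ → ℝ)
    (h1 : ∀ n, ε ≤ 2 * rad n) (h2 : ∀ n, ‖ctr n‖ + rad n ≤ 2) :
    ENNReal.ofReal ((Real.exp (-4) * ε ^ 2 / 4) ^ K * (1 / 2)) ≤
      (∏ k : Fin K, stdComplexGaussian (Metric.closedBall (ctr k) (rad k))) *
        gaussianSeqLaw {x | ∀ n : ℕ, ‖x n‖ ≤ 3 * (n + 1)} := by
  have hball : ∀ n, ENNReal.ofReal (Real.exp (-4) * ε ^ 2 / 4) ≤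
      stdComplexGaussian (Metric.closedBall (ctr n) (rad n)) := by
    intro n
    have hs : 0 ≤ rad n := by linarith [h1 n]
    refine le_trans (ENNReal.ofReal_le_ofReal ?_) (le_stdComplexGaussian_closedBall _ _ hs)
    have h3 : Real.exp (-4) ≤ Real.exp (-(‖ctr n‖ + rad n) ^ 2) :=
      Real.exp_le_exp.2 (by nlinarith [norm_nonneg (ctr n), h2 n])
    calc Real.exp (-4) * ε ^ 2 / 4 = Real.exp (-4) * (ε / 2) ^ 2 := by ring
      _ ≤ Real.exp (-(‖ctr n‖ + rad n) ^ 2) * rad n ^ 2 := by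
        gcongr
        linarith [h1 n]
  have hprod : ENNReal.ofReal (Real.exp (-4) * ε ^ 2 / 4) ^ K ≤
      ∏ k : Fin K, stdComplexGaussian (Metric.closedBall (ctr k) (rad k)) := by
    calc ENNReal.ofReal (Real.exp (-4) * ε ^ 2 / 4) ^ K
        = ∏ _k : Fin K, ENNReal.ofReal (Real.exp (-4) * ε ^ 2 / 4) := by simp
      _ ≤ _ := Finset.prod_le_prod' fun k _ => hball k
  refine le_trans ?_ (mul_le_mul' hprod half_le_gaussianSeqLaw_norm_le_linear)
  rw [← ENNReal.ofReal_pow (by positivity), ← ENNReal.ofReal_mul (by positivity)]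

/-- In each disk factor exp(-4) and 1/4 ≥ exp(-2) cost at most 6δm, and ε² costs 2aδm. There are 2m
+ 1 ≤ 3m factors; the final 1/2 accounts for the added 1. -/
theorem exp_neg_le_pow_mul_half {δ ε a : ℝ} {m : ℕ} (hm : (1 : ℝ) ≤ m)
    (hδm : 1 ≤ δ * m) (ha : 0 ≤ a) (hε : Real.exp (-(a * (δ * m))) ≤ ε) :
    Real.exp (-((3 * (6 + 2 * a) + 1) * (δ * (m : ℝ) ^ 2))) ≤
      (Real.exp (-4) * ε ^ 2 / 4) ^ (2 * m + 1) * (1 / 2) := by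
  have hκ : Real.exp (-((6 + 2 * a) * (δ * m))) ≤ Real.exp (-4) * ε ^ 2 / 4 := by
    have h1 : Real.exp (-2) ≤ 1 / 4 := by
      have : Real.exp (-2) = Real.exp (-1) ^ 2 := by rw [← Real.exp_nat_mul]; norm_num
      rw [this]
      nlinarith [Real.exp_neg_one_lt_half, Real.exp_pos (-1)]
    calc Real.exp (-((6 + 2 * a) * (δ * m)))
        ≤ Real.exp (-4 + (-(a * (δ * m)) + -(a * (δ * m))) + -2) :=
          Real.exp_le_exp.2 (by linarith)
      _ = Real.exp (-4) * (Real.exp (-(a * (δ * m))) ^ 2) * Real.exp (-2) := by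
          rw [Real.exp_add, Real.exp_add, Real.exp_add]
          ring
      _ ≤ Real.exp (-4) * ε ^ 2 * (1 / 4) := by gcongr
      _ = _ := by ring
  have h1 : (2 * m + 1 : ℝ) * (δ * m) ≤ 3 * (δ * (m : ℝ) ^ 2) := by
    calc (2 * m + 1 : ℝ) * (δ * m) ≤ (3 * m) * (δ * m) := by gcongr; linarith
      _ = _ := by ring
  have h2 : 1 ≤ δ * (m : ℝ) ^ 2 := by
    calc (1 : ℝ) ≤ (δ * m) * m := one_le_mul_of_one_le_of_one_le hδm hm
      _ = _ := by ring
  calc Real.exp (-((3 * (6 + 2 * a) + 1) * (δ * (m : ℝ) ^ 2)))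
      ≤ Real.exp ((2 * m + 1 : ℕ) * (-((6 + 2 * a) * (δ * m))) + -1) := by
        apply Real.exp_le_exp.2
        push_cast
        have h3 := mul_le_mul_of_nonneg_left h1 (by linarith : 0 ≤ 6 + 2 * a)
        linarith
    _ = Real.exp (-((6 + 2 * a) * (δ * m))) ^ (2 * m + 1) * Real.exp (-1) := by
        rw [Real.exp_add, Real.exp_nat_mul]
    _ ≤ _ := by
        gcongr
        exact Real.exp_neg_one_lt_half.le

/-- A measurable subset B is produced because the overcrowding event is not itself shown to be
measurable, and B transfers to any Ω. -/
theorem exists_overcrowding_event {L : ℝ} (hL : 0 < L) :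
    ∃ D : ℝ, 1 ≤ D ∧ ∃ A : ℝ, 0 < A ∧ ∀ (r δ : ℝ) (m : ℕ), r = 1 - δ → 0 < δ → δ ≤ 1 / 2 →
      D ≤ δ * m → (∀ n : ℕ, m ≤ n → D * Real.log n ≤ δ * n) →
      ∃ B : Set (ℕ → ℂ), MeasurableSet B ∧ B ⊆ {x | (m : ℕ∞) ≤ zeroCount L x r} ∧
        ENNReal.ofReal (Real.exp (-(A * (δ * (m : ℝ) ^ 2)))) ≤ gaussianSeqLaw B := by
  obtain ⟨p, hp⟩ := exists_nat_ge L
  set c := min L 1 with hc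
  have hc0 : 0 < c := lt_min hL one_pos
  have hc1 : c ≤ 1 := min_le_right _ _
  set S₀ := ∑' j : ℕ, 1 / ((j : ℝ) + 1) ^ 2 with hS₀
  have hS₀0 : 0 ≤ S₀ := tsum_nonneg fun j => by positivity
  set k₀ := -Real.log c with hk₀
  have hk₀0 : 0 ≤ k₀ := by
    have := Real.log_nonpos hc0.le hc1
    linarith
  set A₁ : ℝ := k₀ + 11 + 3 * (p + 1) with hA₁
  have hA₁0 : 0 ≤ A₁ := by positivity
  have hDpos : 0 ≤ 1800 * 2 ^ (p + 1) * S₀ / c := by positivity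
  -- The first term beats the powers of n in the tail, the second gives q ≤ 1, and the third (1800 =
  -- 3 · 600) pushes the tail sum below q/600.
  refine ⟨2 * (p + 5) + 2 ^ p + 1800 * 2 ^ (p + 1) * S₀ / c, by
      have : (0 : ℝ) ≤ 2 ^ p := by positivity
      nlinarith [p.cast_nonneg (α := ℝ)],
    3 * (6 + 2 * A₁) + 1, by positivity, ?_⟩
  intro r δ m hr hδ0 hδ1 hDm hlogD
  set D : ℝ := 2 * (p + 5) + 2 ^ p + 1800 * 2 ^ (p + 1) * S₀ / c with hD
  have h2p : (1 : ℝ) ≤ 2 ^ p := one_le_pow₀ (by norm_num)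
  have hp0 : (0 : ℝ) ≤ p := p.cast_nonneg
  have hr0 : 0 < r := by linarith
  have hr1 : r < 1 := by linarith
  have hmpos : 0 < m := by
    rcases Nat.eq_zero_or_pos m with h | h
    · rw [h] at hDm
      simp at hDm
      linarith
    · exact h
  have hm1 : (1 : ℝ) ≤ m := by exact_mod_cast hmpos
  have hDm' : D ≤ m := hDm.trans (by nlinarith)
  have hlog : ∀ n : ℕ, m ≤ n → (2 * (p + 5) : ℝ) * Real.log n ≤ δ * n := fun n hn => by
    have h1 : 0 ≤ Real.log n := Real.log_natCast_nonneg n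
    refine le_trans ?_ (hlogD n hn)
    gcongr
    linarith
  have hδm : 1 ≤ δ * m := by linarith
  have hlogm : Real.log m ≤ δ * m := by
    have h1 : 0 ≤ Real.log m := Real.log_natCast_nonneg m
    have := hlog m le_rfl
    nlinarith
  set q := hypCoeff L m * r ^ m with hq
  have hq0 : 0 < q := mul_pos (hypCoeff_pos hL m) (by positivity)
  have hqlow : c / ((m : ℝ) + 1) * r ^ m ≤ q := div_mul_pow_le_hypCoeff_mul_pow hL hr0.le m
  have hq1 : q ≤ 1 := hypCoeff_mul_pow_le_one hL hp hr hδ1 hmpos (by linarith) (hlog m le_rfl)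
  -- Chosen so that the crude bound on the whole middle block is exactly q/600.
  set ε := q / (600 * (2 * m + 1 : ℝ) ^ (p + 1)) with hε
  have hpow1 : (1 : ℝ) ≤ (2 * m + 1 : ℝ) ^ (p + 1) := one_le_pow₀ (by linarith)
  have hε0 : 0 < ε := by positivity
  have hεq : ε ≤ q / 600 := by
    rw [hε]
    gcongr
    linarith
  have hεlow : Real.exp (-(A₁ * (δ * m))) ≤ ε := by
    refine (exp_neg_le_div_mul_pow_div hc0 hc1 hr hδ0 hδ1 (by linarith) hδm hlogm).trans ?_
    rw [hε]
    gcongr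
  set ctr : ℕ → ℂ := fun n => if n = 0 then ((q / 4 : ℝ) : ℂ) else
    if n = m then ((3 / 2 : ℝ) : ℂ) else 0 with hctr
  set rad : ℕ → ℝ := fun n => if n = 0 then q / 8 else if n = m then 1 / 2 else ε with hrad
  have hrad1 : ∀ n, ε ≤ 2 * rad n := fun n => by
    simp only [hrad]
    split_ifs <;> linarith
  have hrad2 : ∀ n, ‖ctr n‖ + rad n ≤ 2 := fun n => by
    simp only [hrad, hctr]
    split_ifs
    · rw [Complex.norm_real, Real.norm_of_nonneg (by positivity)]
      linarith
    · rw [Complex.norm_real, Real.norm_of_nonneg (by positivity)]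
      linarith
    · rw [norm_zero]
      linarith
  obtain ⟨hBm, hBeq⟩ := gaussianSeqLaw_head_tail (K := 2 * m + 1)
    (fun k => Metric.closedBall (ctr k) (rad k))
    (fun k => Metric.isClosed_closedBall.measurableSet) (measurableSet_norm_le_linear 3)
  refine ⟨_, hBm, ?_, ?_⟩
  · rintro x ⟨hx1, hx2⟩
    have hx1' : ∀ n ≤ 2 * m, ‖x n - ctr n‖ ≤ rad n := fun n hn => by
      have := hx1 ⟨n, by omega⟩
      rwa [Metric.mem_closedBall, dist_eq_norm] at this
    have hx0 : ‖x 0 - ((q / 4 : ℝ) : ℂ)‖ ≤ q / 8 := by simpa [hctr, hrad] using hx1' 0 (by omega)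
    have hxm : ‖x m - ((3 / 2 : ℝ) : ℂ)‖ ≤ 1 / 2 := by
      simpa [hctr, hrad, hmpos.ne'] using hx1' m (by omega)
    have hn0 : ‖((q / 4 : ℝ) : ℂ)‖ = q / 4 := by
      rw [Complex.norm_real, Real.norm_of_nonneg (by positivity)]
    have hnm : ‖((3 / 2 : ℝ) : ℂ)‖ = 3 / 2 := by
      rw [Complex.norm_real, Real.norm_of_nonneg (by positivity)]
    refine le_zeroCount_of_dominating hL hp hmpos hr0 hr1 hq hε0.le (by linarith) (le_of_eq ?_) ?_
      ?_ ?_ hq1 ?_ ?_ ?_ hx2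
    · rw [hε]
      field_simp
      ring
    · refine (tsum_tail_le hr hδ0 hδ1 hlog).trans ?_
      rw [← hS₀]
      refine le_trans ?_ (div_le_div_of_nonneg_right hqlow (by norm_num))
      have h1 : 1800 * 2 ^ (p + 1) * S₀ ≤ c * ((m : ℝ) + 1) := by
        have : 1800 * 2 ^ (p + 1) * S₀ / c ≤ (m : ℝ) + 1 := by linarith
        rw [div_le_iff₀ hc0] at this
        linarith
      have h2 : 3 * 2 ^ (p + 1) * r ^ m / ((m : ℝ) + 1) ^ 2 * S₀
          = (1800 * 2 ^ (p + 1) * S₀) * (r ^ m / (600 * ((m : ℝ) + 1) ^ 2)) := by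
        field_simp; ring
      rw [h2]
      calc (1800 * 2 ^ (p + 1) * S₀) * (r ^ m / (600 * ((m : ℝ) + 1) ^ 2))
          ≤ (c * ((m : ℝ) + 1)) * (r ^ m / (600 * ((m : ℝ) + 1) ^ 2)) := by gcongr
        _ = _ := by field_simp
    · have := norm_sub_norm_le (((q / 4 : ℝ) : ℂ)) (x 0)
      rw [norm_sub_rev] at this
      linarith
    · have := norm_sub_norm_le (x 0) (((q / 4 : ℝ) : ℂ))
      linarith
    · have := norm_sub_norm_le (((3 / 2 : ℝ) : ℂ)) (x m)
      rw [norm_sub_rev] at this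
      linarith
    · have := norm_sub_norm_le (x m) (((3 / 2 : ℝ) : ℂ))
      linarith
    · intro n hn h0 h1
      simpa [hctr, hrad, h0, h1] using hx1' n hn
  · rw [hBeq]
    refine le_trans (ENNReal.ofReal_le_ofReal ?_)
      (le_gaussianSeqLaw_disks hε0.le (2 * m + 1) ctr rad hrad1 hrad2)
    exact exp_neg_le_pow_mul_half hm1 hδm hA₁0 hεlow

/-! ### Expected inverse moduli at the vertices of a polygon -/

/-- `‖y‖⁻¹` truncated to the disk of radius `M`, with the value `1` at the origin. -/
noncomputable def truncInvNorm (M : ℝ) (y : ℂ) : ℝ≥0∞ :=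
  if ‖y‖ ≤ M then ENNReal.ofReal (Real.exp (-Real.log ‖y‖)) else 0

theorem measurable_truncInvNorm (M : ℝ) : Measurable (truncInvNorm M) :=
  Measurable.ite (measurableSet_le measurable_norm measurable_const) (by fun_prop) measurable_const

/-- The polar Jacobian cancels the singularity. -/
theorem lintegral_truncInvNorm_le {M : ℝ} (hM : 0 ≤ M) :
    ∫⁻ y, truncInvNorm M y ≤ ENNReal.ofReal (2 * Real.pi * M) := by
  rw [← Complex.lintegral_comp_polarCoord_symm]
  have hmt : MeasurableSet polarCoord.target := polarCoord.open_target.measurableSet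
  have hms : MeasurableSet (Ioc (0 : ℝ) M ×ˢ Ioo (-Real.pi) Real.pi) :=
    measurableSet_Ioc.prod measurableSet_Ioo
  calc ∫⁻ p in polarCoord.target, ENNReal.ofReal p.1 • truncInvNorm M (Complex.polarCoord.symm p)
      ≤ ∫⁻ p in polarCoord.target,
          (Ioc (0 : ℝ) M ×ˢ Ioo (-Real.pi) Real.pi).indicator (fun _ => (1 : ℝ≥0∞)) p := by
        refine setLIntegral_mono' hmt fun p hp => ?_
        have hp1 : 0 < p.1 := hp.1
        rw [truncInvNorm, Complex.norm_polarCoord_symm, abs_of_pos hp1]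
        split_ifs with h
        · rw [indicator_of_mem (show p ∈ Ioc (0 : ℝ) M ×ˢ Ioo (-Real.pi) Real.pi from ⟨⟨hp1, h⟩, hp.2⟩), smul_eq_mul,
            ← ENNReal.ofReal_mul hp1.le, Real.exp_neg, Real.exp_log hp1, mul_inv_cancel₀ hp1.ne']
          simp
        · simp
    _ ≤ ∫⁻ p : ℝ × ℝ,
          (Ioc (0 : ℝ) M ×ˢ Ioo (-Real.pi) Real.pi).indicator (fun _ => (1 : ℝ≥0∞)) p :=
        setLIntegral_le_lintegral _ _
    _ = ENNReal.ofReal (2 * Real.pi * M) := by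
        rw [lintegral_indicator_const hms, one_mul, Measure.volume_eq_prod, Measure.prod_prod,
          Real.volume_Ioc, Real.volume_Ioo, ← ENNReal.ofReal_mul (by linarith)]
        congr 1
        ring

theorem pi_stdComplexGaussian_eq_withDensity (K : ℕ) :
    (Measure.pi fun _ : Fin K => stdComplexGaussian) =
      (volume : Measure (Fin K → ℂ)).withDensity
        fun x => ∏ k, ENNReal.ofReal (Real.exp (-‖x k‖ ^ 2) / Real.pi) := by
  refine Measure.pi_eq fun s hs => ?_
  rw [withDensity_apply _ (MeasurableSet.univ_pi hs),
    ← lintegral_indicator (MeasurableSet.univ_pi hs)]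
  have h1 : (univ.pi s).indicator (fun x : Fin K → ℂ =>
        ∏ k, ENNReal.ofReal (Real.exp (-‖x k‖ ^ 2) / Real.pi))
      = fun x => ∏ k, (s k).indicator
          (fun z => ENNReal.ofReal (Real.exp (-‖z‖ ^ 2) / Real.pi)) (x k) := by
    ext x
    by_cases hx : x ∈ univ.pi s
    · rw [indicator_of_mem hx]
      refine Finset.prod_congr rfl fun k _ => ?_
      rw [indicator_of_mem (hx k trivial)]
    · rw [indicator_of_notMem hx]
      simp only [mem_pi, mem_univ, true_implies, not_forall] at hx
      obtain ⟨k, hk⟩ := hx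
      exact (Finset.prod_eq_zero (Finset.mem_univ k) (indicator_of_notMem hk _)).symm
  rw [h1, volume_pi, lintegral_fin_prod_eq_prod _ _ _
    fun k => stdComplexGaussian_density_measurable.indicator (hs k)]
  refine Finset.prod_congr rfl fun k _ => ?_
  rw [lintegral_indicator (hs k), stdComplexGaussian, withDensity_apply _ (hs k)]

theorem lintegral_pi_stdComplexGaussian_le {K : ℕ} {F : (Fin K → ℂ) → ℝ≥0∞} (hF : Measurable F) :
    ∫⁻ x, F x ∂(Measure.pi fun _ => stdComplexGaussian) ≤
      ENNReal.ofReal (1 / Real.pi) ^ K * ∫⁻ x, F x := by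
  rw [pi_stdComplexGaussian_eq_withDensity, lintegral_withDensity_eq_lintegral_mul _ (by fun_prop) hF,
    ← lintegral_const_mul _ hF]
  refine lintegral_mono fun x => mul_le_mul_left ?_ (F x)
  calc ∏ k, ENNReal.ofReal (Real.exp (-‖x k‖ ^ 2) / Real.pi)
      ≤ ∏ _k : Fin K, ENNReal.ofReal (1 / Real.pi) := by
        refine Finset.prod_le_prod' fun k _ => ENNReal.ofReal_le_ofReal ?_
        gcongr
        exact Real.exp_le_one_iff.2 (by nlinarith [sq_nonneg ‖x k‖])
    _ = _ := by simp

theorem det_restrictScalars_toLin' {K : ℕ} (A : Matrix (Fin K) (Fin K) ℂ) :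
    LinearMap.det ((Matrix.toLin' A).restrictScalars ℝ) = ‖A.det‖ ^ 2 := by
  rw [LinearMap.det_restrictScalars, LinearMap.det_toLin', Algebra.norm_complex_apply,
    Complex.normSq_eq_norm_sq]

/-- A product function of an invertible affine image of a Gaussian vector: the density of the image
is bounded by the inverse Jacobian. -/
theorem lintegral_prod_mulVec_add_le {K : ℕ} (A : Matrix (Fin K) (Fin K) ℂ) (hA : A.det ≠ 0)
    (t : Fin K → ℂ) {g : ℂ → ℝ≥0∞} (hg : Measurable g) :
    ∫⁻ x, ∏ j, g ((A *ᵥ x) j + t j) ∂(Measure.pi fun _ => stdComplexGaussian) ≤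
      ENNReal.ofReal (1 / Real.pi) ^ K *
        (ENNReal.ofReal (‖A.det‖ ^ 2)⁻¹ * (∫⁻ y, g y) ^ K) := by
  set f : (Fin K → ℂ) →ₗ[ℝ] (Fin K → ℂ) := (Matrix.toLin' A).restrictScalars ℝ with hf
  have hfm : Measurable f := f.continuous_of_finiteDimensional.measurable
  have hfx : ∀ x, f x = A *ᵥ x := fun x => by simp [hf]
  have hG : Measurable fun y : Fin K → ℂ => ∏ j, g (y j + t j) :=
    Finset.measurable_fun_prod _ fun j _ =>
      hg.comp ((measurable_pi_apply j).add_const _)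
  have hdet : LinearMap.det f ≠ 0 := by
    rw [hf, det_restrictScalars_toLin']
    exact pow_ne_zero _ (norm_ne_zero_iff.2 hA)
  have hmeas : Measurable fun x : Fin K → ℂ => ∏ j, g ((A *ᵥ x) j + t j) := by
    simpa only [Function.comp_def, hfx] using hG.comp hfm
  refine (lintegral_pi_stdComplexGaussian_le hmeas).trans (mul_le_mul_right (le_of_eq ?_) _)
  calc ∫⁻ x, ∏ j, g ((A *ᵥ x) j + t j) = ∫⁻ y, ∏ j, g (y j + t j) ∂(volume.map f) := by
        rw [lintegral_map hG hfm]
        simp only [hfx]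
    _ = ENNReal.ofReal (‖A.det‖ ^ 2)⁻¹ * ∫⁻ y : Fin K → ℂ, ∏ j, g (y j + t j) := by
        rw [Measure.map_linearMap_addHaar_eq_smul_addHaar _ hdet, lintegral_smul_measure, hf,
          det_restrictScalars_toLin', abs_of_nonneg (by positivity), smul_eq_mul]
    _ = _ := by
        rw [volume_pi, lintegral_fin_prod_eq_prod (volume : Measure ℂ) K (fun j y => g (y + t j))
          fun j => hg.comp (measurable_add_const _)]
        simp only [lintegral_add_right_eq_self]
        simp

/-- The rows are orthogonal of squared norm K, so F Fᴴ = K · 1; take determinants. -/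
theorem norm_det_dft_sq {K : ℕ} {ω : ℂ} (hω : IsPrimitiveRoot ω K) :
    ‖(Matrix.of fun j k : Fin K => ω ^ ((j : ℕ) * (k : ℕ))).det‖ ^ 2 = (K : ℝ) ^ K := by
  rcases Nat.eq_zero_or_pos K with rfl | hK
  · simp
  set F := Matrix.of fun j k : Fin K => ω ^ ((j : ℕ) * (k : ℕ)) with hF
  have hωn : ‖ω‖ = 1 := hω.norm'_eq_one hK.ne'
  have hω0 : ω ≠ 0 := hω.ne_zero hK.ne'
  have hconj : star ω = ω⁻¹ := (Complex.inv_eq_conj hωn).symm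
  have hmul : F * Fᴴ = (K : ℂ) • (1 : Matrix (Fin K) (Fin K) ℂ) := by
    ext j l
    simp only [Matrix.mul_apply, Matrix.conjTranspose_apply, hF, Matrix.of_apply,
      Matrix.smul_apply, Matrix.one_apply, smul_eq_mul, star_pow, hconj]
    set ζ := ω ^ (j : ℕ) * (ω⁻¹) ^ (l : ℕ) with hζ
    have hterm : ∀ k : Fin K, ω ^ ((j : ℕ) * (k : ℕ)) * ω⁻¹ ^ ((l : ℕ) * (k : ℕ)) = ζ ^ (k : ℕ) := by
      intro k
      rw [hζ, mul_pow, ← pow_mul, ← pow_mul]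
    rw [Finset.sum_congr rfl fun k _ => hterm k, Fin.sum_univ_eq_sum_range (fun k => ζ ^ k)]
    split_ifs with h
    · subst h
      have : ζ = 1 := by rw [hζ, ← mul_pow, mul_inv_cancel₀ hω0, one_pow]
      simp [this]
    · have hζK : ζ ^ K = 1 := by
        rw [hζ, mul_pow, ← pow_mul, ← pow_mul, mul_comm (j : ℕ), mul_comm (l : ℕ), pow_mul, pow_mul,
          hω.pow_eq_one, inv_pow, hω.pow_eq_one]
        simp
      have hζ1 : ζ ≠ 1 := by
        intro h1
        apply h
        apply Fin.ext
        apply hω.pow_inj j.2 l.2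
        rw [hζ, inv_pow] at h1
        exact (mul_inv_eq_one₀ (pow_ne_zero _ hω0)).1 h1
      have hgeom := mul_geom_sum ζ K
      rw [hζK, sub_self] at hgeom
      rw [(mul_eq_zero.1 hgeom).resolve_left (sub_ne_zero.2 hζ1)]
      simp
  have hdet := congrArg Matrix.det hmul
  rw [Matrix.det_mul, Matrix.det_conjTranspose, Matrix.det_smul, Matrix.det_one, mul_one,
    Fintype.card_fin] at hdet
  have h2 := congrArg norm hdet
  rw [norm_mul, norm_star, norm_pow, Complex.norm_natCast] at h2
  rw [sq, h2]

/-- The matrix sending the first `K` coefficients of a power series with weights `b` to the values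
of the partial sum at the vertices `z₀ ω ^ j` of a regular `K`-gon. -/
theorem le_norm_det_evaluation_sq {K : ℕ} (hK : 0 < K) {ω : ℂ} (hω : IsPrimitiveRoot ω K)
    (b : ℕ → ℝ) (z₀ : ℂ) :
    ∏ k ∈ Finset.range K, (b k ^ 2 * ‖z₀‖ ^ (2 * k)) ≤
      ‖(Matrix.of fun j k : Fin K => (b k : ℂ) * (z₀ * ω ^ (j : ℕ)) ^ (k : ℕ)).det‖ ^ 2 := by
  -- The discrete Fourier matrix only helps: its squared determinant K^K is at least 1 and is
  -- dropped.
  have hA : (Matrix.of fun j k : Fin K => (b k : ℂ) * (z₀ * ω ^ (j : ℕ)) ^ (k : ℕ))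
      = (Matrix.of fun j k : Fin K => ω ^ ((j : ℕ) * (k : ℕ))) *
        Matrix.diagonal fun k : Fin K => (b k : ℂ) * z₀ ^ (k : ℕ) := by
    ext j k
    rw [Matrix.mul_diagonal, Matrix.of_apply, Matrix.of_apply, mul_pow, ← pow_mul]
    ring
  rw [hA, Matrix.det_mul, Matrix.det_diagonal, norm_mul, mul_pow, norm_det_dft_sq hω, norm_prod,
    ← Finset.prod_pow]
  have hP : ∏ k : Fin K, ‖(b k : ℂ) * z₀ ^ (k : ℕ)‖ ^ 2
      = ∏ k ∈ Finset.range K, (b k ^ 2 * ‖z₀‖ ^ (2 * k)) := by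
    rw [← Fin.prod_univ_eq_prod_range (fun k => b k ^ 2 * ‖z₀‖ ^ (2 * k))]
    refine Finset.prod_congr rfl fun k _ => ?_
    rw [norm_mul, norm_pow, Complex.norm_real, mul_pow, Real.norm_eq_abs, sq_abs, ← pow_mul,
      mul_comm 2]
  rw [hP]
  have h1 : (1 : ℝ) ≤ (K : ℝ) ^ K := one_le_pow₀ (by exact_mod_cast hK)
  have h0 : 0 ≤ ∏ k ∈ Finset.range K, (b k ^ 2 * ‖z₀‖ ^ (2 * k)) :=
    Finset.prod_nonneg fun k _ => by positivity
  nlinarith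

/-- The part of index at least `K` of the hyperbolic power series, as a limit of partial sums. -/
noncomputable def hypTail (L : ℝ) (K : ℕ) (y : ℕ → ℂ) (z : ℂ) : ℂ :=
  Filter.limUnder Filter.atTop fun m : ℕ =>
    ∑ n ∈ Finset.range m, y n * (hypCoeff L (K + n) : ℂ) * z ^ (K + n)

/-- The hyperbolic power series, split at the index `K`. -/
noncomputable def hypSplit (L : ℝ) (K : ℕ) (x : ℕ → ℂ) (z : ℂ) : ℂ :=
  ∑ n ∈ Finset.range K, x n * (hypCoeff L n : ℂ) * z ^ n + hypTail L K (fun n => x (K + n)) z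

/-- A limit of partial sums is jointly measurable with no convergence hypothesis, as Tonelli
requires. On sequences of linear growth `hypSplit` agrees with the series in the open disk. -/
theorem measurable_hypTail (L : ℝ) (K : ℕ) :
    Measurable fun p : (ℕ → ℂ) × ℂ => hypTail L K p.1 p.2 := by
  unfold hypTail
  refine (StronglyMeasurable.limUnder (l := Filter.atTop) (f := fun (m : ℕ) (p : (ℕ → ℂ) × ℂ) =>
    ∑ n ∈ Finset.range m, p.1 n * (hypCoeff L (K + n) : ℂ) * p.2 ^ (K + n))
    fun m => Measurable.stronglyMeasurable ?_).measurable
  refine Finset.measurable_fun_sum _ fun n _ => ?_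
  have : Measurable fun p : (ℕ → ℂ) × ℂ => p.1 n := (measurable_pi_apply n).comp measurable_fst
  fun_prop

theorem measurable_hypSplit (L : ℝ) (K : ℕ) :
    Measurable fun p : (ℕ → ℂ) × ℂ => hypSplit L K p.1 p.2 := by
  unfold hypSplit
  refine Measurable.add (Finset.measurable_fun_sum _ fun n _ => ?_) ?_
  · have : Measurable fun p : (ℕ → ℂ) × ℂ => p.1 n := (measurable_pi_apply n).comp measurable_fst
    fun_prop
  · have h : Measurable fun p : (ℕ → ℂ) × ℂ => ((fun n => p.1 (K + n)), p.2) :=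
      Measurable.prodMk (measurable_pi_iff.2 fun n =>
        (measurable_pi_apply (K + n)).comp measurable_fst) measurable_snd
    have h2 := (measurable_hypTail L K).comp h
    exact h2

theorem measurable_truncInvNorm_hypSplit (L : ℝ) (K : ℕ) (M : ℝ) {α : Type*} [MeasurableSpace α]
    {f : α → ℕ → ℂ} {g : α → ℂ} (hf : Measurable f) (hg : Measurable g) :
    Measurable fun a => truncInvNorm M (hypSplit L K (f a) (g a)) := by
  have h := (measurable_truncInvNorm M).comp ((measurable_hypSplit L K).comp (hf.prodMk hg))
  exact h

/-- Integrate out the first `K` coefficients. -/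
theorem lintegral_gaussianSeqLaw_le {F : (ℕ → ℂ) → ℝ≥0∞} (hF : Measurable F) {K : ℕ} {C : ℝ≥0∞}
    (h : ∀ y, ∫⁻ x : Fin K → ℂ, F (appendSeq x y) ∂(Measure.pi fun _ => stdComplexGaussian) ≤ C) :
    ∫⁻ x, F x ∂gaussianSeqLaw ≤ C := by
  rw [← (measurePreserving_appendSeq K).lintegral_comp hF,
    lintegral_prod_symm' (fun p : (Fin K → ℂ) × (ℕ → ℂ) => F (appendSeq p.1 p.2))
      (hF.comp (measurable_appendSeq K))]
  calc _ ≤ ∫⁻ _y : ℕ → ℂ, C ∂gaussianSeqLaw := lintegral_mono fun y => h y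
    _ = C := by simp

/-- Tonelli, then Markov's inequality. -/
theorem measure_le_lintegral_circle_le {α : Type*} [MeasurableSpace α] {m : Measure α} [SFinite m]
    {G : α → ℝ → ℝ≥0∞} (hG : Measurable (Function.uncurry G)) {c B : ℝ} (hc : 0 < c)
    (h : ∀ θ, ∫⁻ x, G x θ ∂m ≤ ENNReal.ofReal B) :
    m {x | ENNReal.ofReal c ≤ ∫⁻ θ in Ioc 0 (2 * Real.pi), G x θ} ≤
      ENNReal.ofReal (2 * Real.pi * B / c) := by
  have hint : ∫⁻ x, ∫⁻ θ in Ioc 0 (2 * Real.pi), G x θ ∂volume ∂m ≤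
      ENNReal.ofReal (2 * Real.pi * B) := by
    rw [lintegral_lintegral_swap hG.aemeasurable]
    calc _ ≤ ∫⁻ _θ in Ioc 0 (2 * Real.pi), ENNReal.ofReal B := lintegral_mono fun θ => h θ
      _ = _ := by
          rw [setLIntegral_const, Real.volume_Ioc, sub_zero, mul_comm,
            ← ENNReal.ofReal_mul (by positivity)]
  refine (meas_ge_le_lintegral_div hG.lintegral_prod_right'.aemeasurable (by simpa using hc)
    ENNReal.ofReal_ne_top).trans ?_
  simp only [Function.uncurry_apply_pair]
  rw [ENNReal.ofReal_div_of_pos hc]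
  gcongr

theorem hypSplit_eq_hypGAF {L : ℝ} (hL : 0 < L) (K : ℕ) {x : ℕ → ℂ} {t : ℝ}
    (hx : ∀ n : ℕ, ‖x n‖ ≤ t * (n + 1)) {z : ℂ} (hz : ‖z‖ < 1) :
    hypSplit L K x z = hypGAF L x z := by
  have hs := (summable_hypGAF hL hx hz).of_norm
  rw [hypSplit, hypGAF, ← hs.sum_add_tsum_nat_add K]
  congr 1
  have hs' := (summable_nat_add_iff K).2 hs
  have := hs'.hasSum.tendsto_sum_nat.limUnder_eq
  simp only [add_comm _ K] at this ⊢
  exact this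

/-- With the tail frozen, the values at the vertices have joint density at most π^(-K) / ‖det A‖²,
uniformly in the tail. Each truncated inverse then contributes at most 2πM. -/
theorem lintegral_prod_truncInvNorm_hypSplit_le {L : ℝ} (hL : 0 < L) {K : ℕ} (hK : 0 < K) {M : ℝ}
    (hM : 0 ≤ M) {ω : ℂ} (hω : IsPrimitiveRoot ω K) {z₀ : ℂ} (hz₀ : z₀ ≠ 0) :
    ∫⁻ x, ∏ j : Fin K, truncInvNorm M (hypSplit L K x (z₀ * ω ^ (j : ℕ))) ∂gaussianSeqLaw ≤
      ENNReal.ofReal ((2 * M) ^ K /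
        ∏ k ∈ Finset.range K, (hypCoeff L k ^ 2 * ‖z₀‖ ^ (2 * k))) := by
  set F : (ℕ → ℂ) → ℝ≥0∞ := fun x =>
    ∏ j : Fin K, truncInvNorm M (hypSplit L K x (z₀ * ω ^ (j : ℕ))) with hF
  have hmeas : Measurable F :=
    Finset.measurable_fun_prod _ fun j _ =>
      measurable_truncInvNorm_hypSplit L K M measurable_id measurable_const
  refine lintegral_gaussianSeqLaw_le (K := K) hmeas ?_
  set A := Matrix.of fun j k : Fin K => (hypCoeff L k : ℂ) * (z₀ * ω ^ (j : ℕ)) ^ (k : ℕ) with hA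
  set P := ∏ k ∈ Finset.range K, (hypCoeff L k ^ 2 * ‖z₀‖ ^ (2 * k)) with hP
  have hP0 : 0 < P := Finset.prod_pos fun k _ => by
    have := hypCoeff_pos hL k
    have := norm_pos_iff.2 hz₀
    positivity
  have hPA : P ≤ ‖A.det‖ ^ 2 := le_norm_det_evaluation_sq hK hω _ z₀
  have hdet : A.det ≠ 0 := by
    intro h
    rw [h] at hPA
    norm_num at hPA
    linarith
  have hval : ∀ (x : Fin K → ℂ) (y : ℕ → ℂ) (j : Fin K),
      hypSplit L K (appendSeq x y) (z₀ * ω ^ (j : ℕ))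
        = (A *ᵥ x) j + hypTail L K y (z₀ * ω ^ (j : ℕ)) := by
    intro x y j
    rw [hypSplit]
    simp only [appendSeq_add]
    congr 1
    rw [← Fin.sum_univ_eq_sum_range
      (fun n => appendSeq x y n * (hypCoeff L n : ℂ) * (z₀ * ω ^ (j : ℕ)) ^ n)]
    simp only [appendSeq_fin, Matrix.mulVec, dotProduct, hA, Matrix.of_apply]
    exact Finset.sum_congr rfl fun k _ => by ring
  intro y
  simp only [hF, hval]
  refine (lintegral_prod_mulVec_add_le A hdet (fun j => hypTail L K y (z₀ * ω ^ (j : ℕ)))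
    (measurable_truncInvNorm M)).trans ?_
  calc ENNReal.ofReal (1 / Real.pi) ^ K *
        (ENNReal.ofReal (‖A.det‖ ^ 2)⁻¹ * (∫⁻ y, truncInvNorm M y) ^ K)
      ≤ ENNReal.ofReal (1 / Real.pi) ^ K *
        (ENNReal.ofReal P⁻¹ * ENNReal.ofReal (2 * Real.pi * M) ^ K) := by
        gcongr
        exact lintegral_truncInvNorm_le hM
    _ = ENNReal.ofReal ((2 * M) ^ K / P) := by
        rw [← ENNReal.ofReal_pow (by positivity), ← ENNReal.ofReal_pow (by positivity),
          ← ENNReal.ofReal_mul (by positivity), ← ENNReal.ofReal_mul (by positivity)]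
        congr 1
        rw [show 2 * Real.pi * M = Real.pi * (2 * M) by ring, mul_pow Real.pi, one_div, inv_pow]
        field_simp

/-! ### The upper bound on the probability -/

/-- Outside the event of irregular growth, having `N` zeros is unlikely. -/
theorem gaussianSeqLaw_many_zeros_le {L : ℝ} (hL : 0 < L) {r R M t : ℝ} {N K : ℕ} (hK : 0 < K)
    (hr : 0 < r) (hrR : r < R) (hR : R < 1) (hM1 : 1 ≤ M)
    (hM : ∀ x : ℕ → ℂ, (∀ n : ℕ, ‖x n‖ ≤ t * (n + 1)) → ∀ z, ‖z‖ ≤ R → ‖hypGAF L x z‖ ≤ M) :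
    gaussianSeqLaw {x | x 0 ≠ 0 ∧ (∀ n : ℕ, ‖x n‖ ≤ t * (n + 1)) ∧ (N : ℕ∞) ≤ zeroCount L x r} ≤
      ENNReal.ofReal (Real.exp (-(K * (N * Real.log (R / r) - Real.log M))) * ((2 * M) ^ K /
        ∏ k ∈ Finset.range K, (hypCoeff L k ^ 2 * r ^ (2 * k)))) := by
  set P := ∏ k ∈ Finset.range K, (hypCoeff L k ^ 2 * r ^ (2 * k)) with hP
  have hP0 : 0 < P := Finset.prod_pos fun k _ => by
    have := hypCoeff_pos hL k
    positivity
  set ω := Complex.exp (2 * Real.pi * Complex.I / K) with hω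
  have hprim : IsPrimitiveRoot ω K := Complex.isPrimitiveRoot_exp K hK.ne'
  set η : Fin K → ℝ := fun j => 2 * Real.pi * j / K with hη
  have hcirc : ∀ (θ : ℝ) (j : Fin K), circleMap 0 r (θ + η j) = circleMap 0 r θ * ω ^ (j : ℕ) := by
    intro θ j
    rw [circleMap_zero, circleMap_zero, hω, ← Complex.exp_nat_mul, mul_assoc, ← Complex.exp_add]
    congr 2
    simp only [hη]
    push_cast
    ring
  set G : (ℕ → ℂ) → ℝ → ℝ≥0∞ := fun x θ =>
    ∏ j : Fin K, truncInvNorm M (hypSplit L K x (circleMap 0 r θ * ω ^ (j : ℕ))) with hG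
  have hGm : Measurable (Function.uncurry G) := by
    have hcm : Measurable (circleMap 0 r) := (continuous_circleMap 0 r).measurable
    exact Finset.measurable_fun_prod _ fun j _ =>
      measurable_truncInvNorm_hypSplit L K M measurable_fst
        ((hcm.comp measurable_snd).mul_const (ω ^ (j : ℕ)))
  have hGint : ∀ θ, ∫⁻ x, G x θ ∂gaussianSeqLaw ≤ ENNReal.ofReal ((2 * M) ^ K / P) := by
    intro θ
    have hne : circleMap 0 r θ ≠ 0 := circleMap_ne_center hr.ne'
    have := lintegral_prod_truncInvNorm_hypSplit_le hL hK (by linarith : 0 ≤ M) hprim hne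
    rwa [norm_circleMap_zero, abs_of_pos hr] at this
  set c := 2 * Real.pi * Real.exp (K * (N * Real.log (R / r) - Real.log M)) with hc
  have hc0 : 0 < c := by positivity
  have hsub : {x : ℕ → ℂ | x 0 ≠ 0 ∧ (∀ n : ℕ, ‖x n‖ ≤ t * (n + 1)) ∧
      (N : ℕ∞) ≤ zeroCount L x r} ⊆
      {x | ENNReal.ofReal c ≤ ∫⁻ θ in Ioc 0 (2 * Real.pi), G x θ} := by
    rintro x ⟨hx0, hx, hN⟩
    have hdiff := differentiableOn_hypGAF hL hx
    have han : AnalyticOnNhd ℂ (hypGAF L x) (Metric.closedBall 0 R) :=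
      (hdiff.analyticOnNhd Metric.isOpen_ball).mono (Metric.closedBall_subset_ball hR)
    have hf0 : hypGAF L x 0 ≠ 0 := by
      rw [hypGAF, tsum_eq_single 0 (fun n hn => by simp [hn])]
      simpa [hypCoeff_zero] using hx0
    obtain ⟨Z, hZsub, hZcard⟩ := Set.exists_subset_encard_eq hN
    have hZfin : Z.Finite := Set.finite_of_encard_eq_coe hZcard
    have hZN : hZfin.toFinset.card = N := by
      have h := hZfin.encard_eq_coe_toFinset_card
      rw [hZcard] at h
      exact_mod_cast h.symm
    have hJ := card_zeros_mul_log_add_circleAverage_le hr hrR han hf0 hZfin.toFinset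
      fun z hz => hZsub (hZfin.mem_toFinset.1 hz)
    rw [hZN] at hJ
    have hlogM : ∀ z, ‖z‖ ≤ R → Real.log ‖hypGAF L x z‖ ≤ Real.log M := by
      intro z hz
      rcases (norm_nonneg (hypGAF L x z)).eq_or_lt with h | h
      · rw [← h, Real.log_zero]
        exact Real.log_nonneg hM1
      · exact Real.log_le_log h (hM x hx z hz)
    have hR0 : 0 < R := hr.trans hrR
    have hupper : Real.circleAverage (Real.log ‖hypGAF L x ·‖) 0 R ≤ Real.log M := by
      refine Real.circleAverage_mono_on_of_le_circle ?_ fun z hz => hlogM z ?_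
      · refine MeromorphicOn.circleIntegrable_log_norm ?_
        rw [abs_of_pos hR0]
        exact (han.mono Metric.sphere_subset_closedBall).meromorphicOn
      · rw [abs_of_pos hR0, mem_sphere_zero_iff_norm] at hz
        exact hz.le
    have hint : CircleIntegrable (Real.log ‖hypGAF L x ·‖) 0 r := by
      refine MeromorphicOn.circleIntegrable_log_norm ?_
      rw [abs_of_pos hr]
      exact (han.mono (Metric.sphere_subset_closedBall.trans
        (Metric.closedBall_subset_closedBall hrR.le))).meromorphicOn
    have hconv := ofReal_exp_neg_circleAverage_le hint η
    refine le_trans (ENNReal.ofReal_le_ofReal ?_) (hconv.trans (le_of_eq ?_))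
    · rw [hc]
      gcongr
      rw [← mul_neg]
      gcongr
      linarith
    -- The truncation is inactive since |f| ≤ M here. Zeros on the circle do no harm: both sides use
    -- the convention log 0 = 0.
    · refine lintegral_congr fun θ => Finset.prod_congr rfl fun j _ => ?_
      have hz : ‖circleMap 0 r (θ + η j)‖ = r := by rw [norm_circleMap_zero, abs_of_pos hr]
      rw [← hcirc, hypSplit_eq_hypGAF hL K hx (by rw [hz]; linarith), truncInvNorm,
        if_pos (hM x hx _ (by rw [hz]; exact hrR.le))]
  refine (measure_mono hsub).trans ((measure_le_lintegral_circle_le hGm hc0 hGint).trans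
    (le_of_eq ?_))
  congr 1
  rw [hc, Real.exp_neg]
  field_simp

theorem pow_le_prod_hypCoeff_sq {L : ℝ} (hL : 0 < L) {r δ : ℝ} {N K : ℕ} (hr : r = 1 - δ)
    (hδ0 : 0 < δ) (hδ1 : δ ≤ 1 / 2) (hKN : K ≤ N) :
    (min L 1 / N * Real.exp (-(4 * δ * K))) ^ K ≤
      ∏ k ∈ Finset.range K, (hypCoeff L k ^ 2 * r ^ (2 * k)) := by
  have hc0 : 0 < min L 1 := lt_min hL one_pos
  have hr0 : 0 < r := by linarith
  calc (min L 1 / N * Real.exp (-(4 * δ * K))) ^ K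
      = ∏ _k ∈ Finset.range K, (min L 1 / N * Real.exp (-(4 * δ * K))) := by simp
    _ ≤ _ := by
      refine Finset.prod_le_prod (fun k _ => by positivity) fun k hk => ?_
      have hkK : k < K := Finset.mem_range.1 hk
      have h1 : min L 1 / N ≤ hypCoeff L k ^ 2 := by
        refine le_trans ?_ (le_hypCoeff_sq hL k)
        have : (k : ℝ) + 1 ≤ N := by exact_mod_cast (by omega : k + 1 ≤ N)
        gcongr
      have h2 : Real.exp (-(4 * δ * K)) ≤ r ^ (2 * k) := by
        calc Real.exp (-(4 * δ * K)) = Real.exp (-(2 * δ)) ^ (2 * K) := by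
              rw [← Real.exp_nat_mul]; push_cast; congr 1; ring
          _ ≤ r ^ (2 * K) := by
              rw [hr]
              exact pow_le_pow_left₀ (Real.exp_pos _).le (exp_neg_two_mul_le_one_sub hδ0.le hδ1) _
          _ ≤ r ^ (2 * k) := pow_le_pow_of_le_one hr0.le (by linarith) (by omega)
      exact mul_le_mul h1 h2 (Real.exp_pos _).le (sq_nonneg _)

/-- Per vertex, Jensen gains δN/2. With K ≤ N/16 the powers of r cost at most δN/4, and the constant
and the logarithms at most δN/16 each. This leaves δN/8, raised to the power K ≥ N/32. -/
theorem many_zeros_bound_le {L : ℝ} (hL : 0 < L) {r δ ℓ : ℝ} {N p : ℕ} (hr : r = 1 - δ)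
    (hδ0 : 0 < δ) (hδ1 : δ ≤ 1 / 2) (hN : 32 ≤ N) (hℓ : δ / 2 ≤ ℓ)
    (hc : 16 * Real.log (2 / min L 1) ≤ δ * N)
    (hlog : 16 * (2 * (p + 4) + 1) * Real.log N ≤ δ * N) :
    Real.exp (-((N / 16 : ℕ) * (N * ℓ - Real.log ((N : ℝ) ^ (p + 4))))) *
      ((2 * (N : ℝ) ^ (p + 4)) ^ (N / 16) /
        ∏ k ∈ Finset.range (N / 16), (hypCoeff L k ^ 2 * r ^ (2 * k))) ≤
      Real.exp (-(δ * (N : ℝ) ^ 2 / 256)) := by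
  have hc0 : 0 < min L 1 := lt_min hL one_pos
  have hNpos : (0 : ℝ) < N := by exact_mod_cast (by omega : 0 < N)
  set K := N / 16 with hK
  have hK1 : (K : ℝ) ≤ N / 16 := by
    have : 16 * K ≤ N := Nat.mul_div_le N 16
    have : (16 : ℝ) * K ≤ N := by exact_mod_cast this
    linarith
  have hK2 : (N : ℝ) / 32 ≤ K := by
    have : N ≤ 32 * K := by omega
    have : (N : ℝ) ≤ 32 * K := by exact_mod_cast this
    linarith
  have hprod := pow_le_prod_hypCoeff_sq hL hr hδ0 hδ1 (Nat.div_le_self N 16)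
  rw [← hK] at hprod
  set M := (N : ℝ) ^ (p + 4) with hM
  have hM0 : 0 < M := by positivity
  have hq0 : 0 < min L 1 / N * Real.exp (-(4 * δ * K)) := by positivity
  have hbase : Real.exp (-(N * ℓ - Real.log M)) * (2 * M /
      (min L 1 / N * Real.exp (-(4 * δ * K)))) ≤ Real.exp (-(δ * N / 8)) := by
    have e1 : 2 * M / (min L 1 / N * Real.exp (-(4 * δ * K)))
        = Real.exp (Real.log (2 / min L 1) + Real.log M + Real.log N + 4 * δ * K) := by
      rw [Real.exp_add, Real.exp_add, Real.exp_add, Real.exp_log (by positivity),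
        Real.exp_log hM0, Real.exp_log hNpos, Real.exp_neg]
      field_simp
    rw [e1, ← Real.exp_add]
    apply Real.exp_le_exp.2
    have e2 : Real.log M = (p + 4) * Real.log N := by
      rw [hM, Real.log_pow]
      push_cast
      ring
    have e3 : (N : ℝ) * (δ / 2) ≤ N * ℓ := by gcongr
    have e4 : 4 * δ * K ≤ δ * N / 4 := by nlinarith
    rw [e2]
    linarith
  calc _ ≤ Real.exp (-(K * (N * ℓ - Real.log M))) * ((2 * M) ^ K /
        (min L 1 / N * Real.exp (-(4 * δ * K))) ^ K) := by gcongr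
    _ = (Real.exp (-(N * ℓ - Real.log M)) * (2 * M /
          (min L 1 / N * Real.exp (-(4 * δ * K))))) ^ K := by
        rw [mul_pow (Real.exp _), div_pow, ← Real.exp_nat_mul, mul_neg]
    _ ≤ Real.exp (-(δ * N / 8)) ^ K := by gcongr
    _ = Real.exp (-(K * (δ * N / 8))) := by rw [← Real.exp_nat_mul, mul_neg]
    _ ≤ _ := by
        apply Real.exp_le_exp.2
        have : 0 ≤ δ * N / 8 := by positivity
        nlinarith

theorem gaussianSeqLaw_overcrowding_le {L : ℝ} (hL : 0 < L) :
    ∃ D : ℝ, 1 ≤ D ∧ ∀ (r δ : ℝ) (N : ℕ), r = 1 - δ → 0 < δ → δ ≤ 1 / 2 →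
      D ≤ δ * N → 2 / δ ≤ N → D * Real.log N ≤ δ * N →
      gaussianSeqLaw {x | (N : ℕ∞) ≤ zeroCount L x r} ≤
        ENNReal.ofReal (Real.exp (-(δ * (N : ℝ) ^ 2 / 512))) := by
  obtain ⟨p, hp⟩ := exists_nat_ge L
  have hc0 : 0 < min L 1 := lt_min hL one_pos
  have hlc : 0 ≤ Real.log (2 / min L 1) := by
    apply Real.log_nonneg
    rw [le_div_iff₀ hc0]
    linarith [min_le_right L 1]
  have hp0 : (0 : ℝ) ≤ p := p.cast_nonneg
  have hf0 : (0 : ℝ) ≤ ((p + 1).factorial : ℝ) := by positivity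
  refine ⟨16 * (2 * (p + 4) + 1) + 16 * Real.log (2 / min L 1) + (p + 1).factorial + 1024,
    by linarith, ?_⟩
  intro r δ N hr hδ0 hδ1 hDN hδN hDlog
  have hN0 : (0 : ℝ) ≤ N := N.cast_nonneg
  have hδN' : δ * N ≤ N := by nlinarith
  have hN32 : 32 ≤ N := by exact_mod_cast (by linarith : (32 : ℝ) ≤ N)
  have hN1 : (1 : ℝ) ≤ N := by linarith
  have hlogN : 0 ≤ Real.log N := Real.log_natCast_nonneg N
  have hr0 : 0 < r := by linarith
  set R := 1 - δ / 2 with hR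
  have hrR : r < R := by rw [hr, hR]; linarith
  have hR1 : R < 1 := by rw [hR]; linarith
  have hℓ : δ / 2 ≤ Real.log (R / r) := by
    have h1 := Real.one_sub_inv_le_log_of_pos (div_pos (hr0.trans hrR) hr0)
    refine le_trans ?_ h1
    rw [inv_div, le_sub_iff_add_le, ← le_sub_iff_add_le', div_le_iff₀ (hr0.trans hrR)]
    rw [hr, hR]
    nlinarith
  -- The exponent p + 4 collects N from the growth rate, N for the factorial, and N^(p+2) for the
  -- powers of 2/δ ≤ N.
  have hgrowM : ∀ x : ℕ → ℂ, (∀ n : ℕ, ‖x n‖ ≤ N * (n + 1)) → ∀ z, ‖z‖ ≤ R →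
      ‖hypGAF L x z‖ ≤ (N : ℝ) ^ (p + 4) := by
    intro x hx z hz
    refine (norm_hypGAF_le hL hp hx hR1 hz).trans ?_
    have e1 : 1 - R = (2 / δ)⁻¹ := by rw [hR, inv_div]; ring
    have e2 : ((p + 1).factorial : ℝ) ≤ N := by linarith
    rw [e1, inv_pow, div_inv_eq_mul]
    calc (N : ℝ) * ((p + 1).factorial * (2 / δ) ^ (p + 2)) ≤ N * (N * (N : ℝ) ^ (p + 2)) := by
          gcongr
      _ = _ := by ring
  have hmain := gaussianSeqLaw_many_zeros_le (N := N) hL (K := N / 16) (by omega) hr0 hrR hR1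
    (one_le_pow₀ hN1 : (1 : ℝ) ≤ (N : ℝ) ^ (p + 4)) hgrowM
  have hnum := many_zeros_bound_le hL (p := p) hr hδ0 hδ1 hN32 hℓ (by linarith) (by
    refine le_trans ?_ hDlog
    gcongr
    linarith)
  have hzero : gaussianSeqLaw {x | x 0 = 0} = 0 := by
    have := gaussianSeqLaw_eval 0 (measurableSet_singleton (0 : ℂ))
    rw [stdComplexGaussian_singleton] at this
    exact this
  have hsub : {x : ℕ → ℂ | (N : ℕ∞) ≤ zeroCount L x r} ⊆
      {x | x 0 ≠ 0 ∧ (∀ n : ℕ, ‖x n‖ ≤ N * (n + 1)) ∧ (N : ℕ∞) ≤ zeroCount L x r} ∪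
        ({x | x 0 = 0} ∪ {x | ∃ n : ℕ, N * ((n : ℝ) + 1) < ‖x n‖}) := by
    intro x hx
    by_cases h0 : x 0 = 0
    · exact Or.inr (Or.inl h0)
    · by_cases hg : ∀ n : ℕ, ‖x n‖ ≤ N * (n + 1)
      · exact Or.inl ⟨h0, hg, hx⟩
      · push Not at hg
        exact Or.inr (Or.inr hg)
  calc gaussianSeqLaw {x | (N : ℕ∞) ≤ zeroCount L x r}
      ≤ ENNReal.ofReal (Real.exp (-(δ * (N : ℝ) ^ 2 / 256))) +
          (0 + ENNReal.ofReal (4 * Real.exp (-(N : ℝ) ^ 2 / 2))) := by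
        refine (measure_mono hsub).trans ((measure_union_le _ _).trans (add_le_add ?_
          ((measure_union_le _ _).trans (add_le_add hzero.le ?_))))
        · exact hmain.trans (ENNReal.ofReal_le_ofReal hnum)
        · exact gaussianSeqLaw_exists_norm_gt_le hN1
    _ = ENNReal.ofReal (Real.exp (-(δ * (N : ℝ) ^ 2 / 256)) +
          4 * Real.exp (-(N : ℝ) ^ 2 / 2)) := by
        rw [zero_add, ENNReal.ofReal_add (Real.exp_pos _).le (by positivity)]
    _ ≤ _ := by
        apply ENNReal.ofReal_le_ofReal
        have h1 : Real.exp (-(N : ℝ) ^ 2 / 2) ≤ Real.exp (-(δ * (N : ℝ) ^ 2 / 256)) :=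
          Real.exp_le_exp.2 (by nlinarith [sq_nonneg (N : ℝ)])
        -- Half of the exponent is given up to absorb the factor 1 + 4 from the two events.
        have h2 : Real.exp (-(δ * (N : ℝ) ^ 2 / 256))
            = Real.exp (-(δ * (N : ℝ) ^ 2 / 512)) * Real.exp (-(δ * (N : ℝ) ^ 2 / 512)) := by
          rw [← Real.exp_add]; congr 1; ring
        have h3 : Real.exp (-(δ * (N : ℝ) ^ 2 / 512)) ≤ 1 / 5 := by
          have h4 : 2 ≤ δ * (N : ℝ) ^ 2 / 512 := by
            have : (1024 : ℝ) * 1 ≤ (δ * N) * N := by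
              refine mul_le_mul (by linarith) hN1 (by norm_num) (by positivity)
            nlinarith
          have h5 : Real.exp (-(δ * (N : ℝ) ^ 2 / 512)) ≤ Real.exp (-2) :=
            Real.exp_le_exp.2 (by linarith)
          have h6 : (5 : ℝ) ≤ Real.exp 2 := by
            have : Real.exp 2 = Real.exp 1 ^ 2 := by rw [← Real.exp_nat_mul]; norm_num
            rw [this]
            nlinarith [Real.exp_one_gt_d9]
          rw [Real.exp_neg 2] at h5
          refine h5.trans ?_
          rw [one_div]
          exact inv_anti₀ (by norm_num) h6
        have h7 := Real.exp_pos (-(δ * (N : ℝ) ^ 2 / 512))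
        nlinarith

/-! ### Transfer to the probability space and conclusion -/

theorem ofReal_le_toENNReal_iff {V : ℝ} (e : ℕ∞) :
    ENNReal.ofReal V ≤ (e : ℝ≥0∞) ↔ ((⌈V⌉₊ : ℕ) : ℕ∞) ≤ e := by
  induction e using ENat.recTopCoe with
  | top => simp
  | coe n =>
    rw [ENat.toENNReal_coe, Nat.cast_le, Nat.ceil_le, ENNReal.ofReal_le_natCast]

theorem theorem1p2 (L : ℝ) (hL : 0 < L) :
    ∃ C_L : ℝ, 0 < C_L ∧ ∃ a A : ℝ, 0 < a ∧ 0 < A ∧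
      ∀ (Ω : Type*) [MeasurableSpace Ω] (P : Measure Ω) [IsProbabilityMeasure P]
        (ξ : ℕ → Ω → ℂ), IsGaussianSequence P ξ →
        ∀ r ∈ Set.Ico (1 / 2 : ℝ) 1, ∀ V : ℝ, 1 < V →
          C_L / (1 - r) * Real.log (1 / (1 - r)) ≤ V →
          a * ((1 - r) * V ^ 2) ≤ -Real.log (P.real (overcrowding L ξ r V)) ∧
          -Real.log (P.real (overcrowding L ξ r V)) ≤ A * ((1 - r) * V ^ 2) := by
  obtain ⟨D₁, hD₁, hupper⟩ := gaussianSeqLaw_overcrowding_le hL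
  obtain ⟨D₂, hD₂, A, hA, hlower⟩ := exists_overcrowding_event hL
  obtain ⟨C, hC, hlarge⟩ := exists_log_le_mul (D := D₁ + D₂) (by linarith)
  -- Rounding up gives V ≤ N ≤ 2V: the first inequality costs nothing, the second squares to the
  -- factor 4.
  refine ⟨C, hC, 1 / 512, 4 * A, by norm_num, by positivity, ?_⟩
  intro Ω _ P _ ξ hξ r hr V hV hCV
  set δ := 1 - r with hδ
  have hδ0 : 0 < δ := by linarith [hr.2]
  have hδ1 : δ ≤ 1 / 2 := by linarith [hr.1]
  set N := ⌈V⌉₊ with hN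
  have hVN : V ≤ N := Nat.le_ceil V
  have hN2 : (N : ℝ) ≤ 2 * V := by linarith [Nat.ceil_lt_add_one (by linarith : 0 ≤ V)]
  have hN0 : (0 : ℝ) ≤ N := N.cast_nonneg
  have hlargeN : ∀ n : ℕ, N ≤ n → D₁ + D₂ ≤ δ * n ∧ 2 / δ ≤ n ∧
      (D₁ + D₂) * Real.log n ≤ δ * n := fun n hn =>
    hlarge δ n hδ0 hδ1 (hCV.trans (hVN.trans (by exact_mod_cast hn)))
  obtain ⟨hb1, hb2, hb3⟩ := hlargeN N le_rfl
  have hlog0 : ∀ n : ℕ, 0 ≤ Real.log n := Real.log_natCast_nonneg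
  have hrδ : r = 1 - δ := by rw [hδ]; ring
  have hset : overcrowding L ξ r V
      = (fun ω n => ξ n ω) ⁻¹' {x | (N : ℕ∞) ≤ zeroCount L x r} := by
    ext ω
    exact ofReal_le_toENNReal_iff _
  have hlaw := hξ.hasLaw_seq
  have hU := hupper r δ N hrδ hδ0 hδ1 (by linarith) hb2 (by nlinarith [hlog0 N])
  obtain ⟨B, hBm, hBsub, hBlow⟩ := hlower r δ N hrδ hδ0 hδ1 (by linarith)
    fun n hn => by nlinarith [hlog0 n, (hlargeN n hn).2.2]
  -- The inequality `Measure.le_map_apply` holds for every set, so no measurability of the event is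
  -- needed.
  have hPupper : P.real (overcrowding L ξ r V) ≤ Real.exp (-(δ * (N : ℝ) ^ 2 / 512)) := by
    refine ENNReal.toReal_le_of_le_ofReal (Real.exp_pos _).le (le_trans ?_ hU)
    rw [hset, ← hlaw.map_eq]
    exact Measure.le_map_apply hlaw.aemeasurable _
  have hPlower : Real.exp (-(A * (δ * (N : ℝ) ^ 2))) ≤ P.real (overcrowding L ξ r V) := by
    refine (ENNReal.ofReal_le_iff_le_toReal (measure_ne_top _ _)).1 (hBlow.trans ?_)
    rw [hset, ← hlaw.map_eq, Measure.map_apply_of_aemeasurable hlaw.aemeasurable hBm]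
    exact measure_mono (preimage_mono hBsub)
  have hPpos : 0 < P.real (overcrowding L ξ r V) := (Real.exp_pos _).trans_le hPlower
  constructor
  · have h1 := Real.log_le_log hPpos hPupper
    rw [Real.log_exp] at h1
    have h2 : δ * V ^ 2 ≤ δ * (N : ℝ) ^ 2 := by gcongr
    linarith
  · have h1 := Real.log_le_log (Real.exp_pos _) hPlower
    rw [Real.log_exp] at h1
    have h2 : A * (δ * (N : ℝ) ^ 2) ≤ A * (δ * (2 * V) ^ 2) := by gcongr
    calc _ ≤ A * (δ * (N : ℝ) ^ 2) := by linarith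
      _ ≤ A * (δ * (2 * V) ^ 2) := h2
      _ = _ := by ring
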